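/- Let $\Omega\subset\mathbb{R}^3$ be the convex hull of the two disks $\{x^2+y^2\le 1,\ z=0\}$ and $\{x^2+z^2\le 1,\ y=0\}$. For a unit vector $v$ let $w(v)$ be the distance between the two supporting planes of $\Omega$ orthogonal to $v$, i.e. $w(v)=h_\Omega(v)+h_\Omega(-v)$ with the support function $h_K(v)=\sup_{p\in K}\langle v,p\rangle$. Let the mean width $MW_1$ of $\Omega$ be the average of $w(v)$ over $v$ uniformly distributed on $S^2$. Then $w$ is integrable on $S^2$, and $$MW_1=-\frac1\pi\Bigl(2\sqrt2\,\ln(\sqrt2-1)-4\,\mathrm{Li}_2(\sqrt2-1)+4\,\mathrm{Li}_2(1-\sqrt2)\Bigr)=1.8697727582861870379136441\dots,$$ where $\mathrm{Li}_2(x)=\sum_{k\ge1}x^k/k^2$ for $|x|\le1$ (the decimal is truncated, not rounded). Moreover $MW_1$ is given by each of the following two kinds of formula. (i) Curvature and dihedral angles. The boundary of $\Omega$ is $\partial\Omega=\{x^2+y^2\le1,\ z=\pm(\sqrt{1-x^2}-|y|)\}$. It consists of four smooth faces, the graphs $z=\sigma(\sqrt{1-x^2}-\tau y)$ over $\{x^2+y^2<1,\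 \tau y>0\}$ with $\sigma,\tau\in\{1,-1\}$, together with the four semicircular edges $\{x^2+y^2=1,\ z=0,\ \tau y\ge0\}$ and $\{x^2+z^2=1,\ y=0,\ \sigma z\ge0\}$. Let $H$ be the mean curvature of the faces (the average of the principal curvatures, with respect to the exterior normal, positive for a sphere). At a point of an edge $\varepsilon_j$ let $\alpha_j$ be the exterior dihedral angle, that is, the angle between the exterior unit normals of the two faces meeting there (unit vectors $n$ with $\langle n,q-p\rangle\le0$ for all $q\in\Omega$, where $p$ is the point of the face, extended continuously to the edges away from $x=\pm1$). Then $H$ is integrable over the faces, each $\alpha_j$ is integrable over its edge, and $$MW_1=\frac1{2\pi}\int_{\partial\Omega}H\,dS+\frac1{4\pi}\sum_{j=1}^4\int_{\varepsilon_j}\alpha_j\,ds =\frac4{2\pi}\int_{-1}^1\int_0^{\sqrt{1-x^2}}\frac{dy\,dx}{(2-x^2)\sqrt{1-x^2}}+\frac8{4\pi}\int_0^\pi\arccos\Bigl(\frac1{\sqrt{2-\cos^2\theta}}\Bigr)d\theta .$$ (ii) Support functions. For $v=(a,b,c)\in\mathbb{R}^3$ the two disks have support functions $\sqrt{a^2+b^2}$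 and $\sqrt{a^2+c^2}$, the support function of $\Omega$ is the maximum of these two, and $$MW_1=2\int_0^{\pi/2}\int_0^{\pi/2}\max\Bigl\{\sin\phi,\sqrt{\cos^2\theta\sin^2\phi+\cos^2\phi}\Bigr\}\frac2\pi\sin\phi\,d\phi\,d\theta =\frac8\pi\int_0^{\pi/2}\int_{\xi(\theta)}^{\pi/2}\sin^2\phi\,d\phi\,d\theta,$$ where $\xi(\theta)=\arccos\bigl(\sin\theta/\sqrt{2-\cos^2\theta}\bigr)$. -/

import Mathlib

open MeasureTheory Real

noncomputable section

namespace TwoDisks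

/-- Euclidean three-space, with coordinates `p 0 = x`, `p 1 = y`, `p 2 = z`. -/
abbrev E3 : Type := EuclideanSpace ℝ (Fin 3)

/-! ### Mean width -/

/-- Support function of a (nonempty, bounded) set `K`. For a unit vector `v` and compact `K`, the
supporting plane of `K` with exterior normal `v` is `{x | ⟪v, x⟫ = supportFun K v}`. -/
def supportFun (K : Set E3) (v : E3) : ℝ :=
  sSup ((fun x : E3 => inner ℝ v x) '' K)

/-- Width of `K` in the direction of the unit vector `v`: the distance between the two supporting
planes `{x | ⟪v, x⟫ = supportFun K v}` and `{x | ⟪v, x⟫ = -supportFun K (-v)}`. -/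
def width (K : Set E3) (v : E3) : ℝ :=
  supportFun K v + supportFun K (-v)

/-- Mean width: the average of the width over the unit sphere, with respect to the (normalised)
surface measure on the sphere. -/
def meanWidth (K : Set E3) : ℝ :=
  ⨍ v : Metric.sphere (0 : E3) 1, width K (v : E3) ∂((volume : Measure E3).toSphere)

/-- The dilogarithm `∑_{k ≥ 1} x ^ k / k ^ 2`, for `|x| ≤ 1`. -/
def dilog (x : ℝ) : ℝ := ∑' k : ℕ, x ^ (k + 1) / ((k : ℝ) + 1) ^ 2

/-! ### The convex hull of the two disks -/

/-- The disk `x² + y² ≤ 1`, `z = 0`. -/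
def diskXY : Set E3 := {p | p 0 ^ 2 + p 1 ^ 2 ≤ 1 ∧ p 2 = 0}

/-- The disk `x² + z² ≤ 1`, `y = 0`. -/
def diskXZ : Set E3 := {p | p 0 ^ 2 + p 2 ^ 2 ≤ 1 ∧ p 1 = 0}

/-- The convex hull of the two disks. -/
def Ω : Set E3 := convexHull ℝ (diskXY ∪ diskXZ)

/-! ### Geometry of graphs `z = f x y` -/

/-- Partial derivative in the first variable. -/
def dx (f : ℝ → ℝ → ℝ) (x y : ℝ) : ℝ := deriv (fun t => f t y) x

/-- Partial derivative in the second variable. -/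
def dy (f : ℝ → ℝ → ℝ) (x y : ℝ) : ℝ := deriv (fun t => f x t) y

/-- Surface area density of the graph of `f`, that is `dS = areaDensity f x y dx dy`. -/
def areaDensity (f : ℝ → ℝ → ℝ) (x y : ℝ) : ℝ := √(1 + dx f x y ^ 2 + dy f x y ^ 2)

/-- Upward unit normal vector of the graph of `f`. -/
def upNormal (f : ℝ → ℝ → ℝ) (x y : ℝ) : E3 :=
  (1 / areaDensity f x y) • !₂[-dx f x y, -dy f x y, 1]

/-- Mean curvature (the average of the principal curvatures) of the graph of `f` with respect to
the upward normal, with the sign for which the upper half of a sphere has positive curvature. -/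
def graphMeanCurvature (f : ℝ → ℝ → ℝ) (x y : ℝ) : ℝ :=
  -((1 + dx f x y ^ 2) * dy (dy f) x y - 2 * dx f x y * dy f x y * dy (dx f) x y
      + (1 + dy f x y ^ 2) * dx (dx f) x y)
    / (2 * (1 + dx f x y ^ 2 + dy f x y ^ 2) ^ ((3 : ℝ) / 2))

/-! ### The four faces and the four edges of the boundary

The signs `σ, τ ∈ {1, -1}` are the signs of `z` and of `y`. -/

/-- The face with signs `σ, τ` is the graph `z = faceFun σ τ x y` over `faceDomain τ`. -/
def faceFun (σ τ : ℝ) (x y : ℝ) : ℝ := σ * (√(1 - x ^ 2) - τ * y)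

/-- The open half disk over which a face is a graph. -/
def faceDomain (τ : ℝ) : Set (ℝ × ℝ) := {q | q.1 ^ 2 + q.2 ^ 2 < 1 ∧ 0 < τ * q.2}

/-- Exterior unit normal of the face with signs `σ, τ` above or below `(x, y)`: upward on the upper
faces, downward on the lower faces. Its values with `0 ≤ τ * y ≤ √(1 - x ^ 2)`, `|x| < 1` include
the continuous extension of the normal to the edges of the face. -/
def faceNormal (σ τ : ℝ) (x y : ℝ) : E3 := σ • upNormal (faceFun σ τ) x y

/-- Mean curvature of the face with respect to the exterior normal. -/
def faceMeanCurvature (σ τ : ℝ) (x y : ℝ) : ℝ := σ * graphMeanCurvature (faceFun σ τ) x y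

/-- The integrand of `∫ H dS` over the face with signs `σ, τ`, in the coordinates `(x, y)`. -/
def faceIntegrand (σ τ : ℝ) (q : ℝ × ℝ) : ℝ :=
  faceMeanCurvature σ τ q.1 q.2 * areaDensity (faceFun σ τ) q.1 q.2

/-- The semicircular edge `x² + y² = 1`, `z = 0` on the side `τ * y ≥ 0`, for `t ∈ [0, π]`. -/
def edgeXY (τ : ℝ) (t : ℝ) : E3 := !₂[cos t, τ * sin t, 0]

/-- The semicircular edge `x² + z² = 1`, `y = 0` on the side `σ * z ≥ 0`, for `t ∈ [0, π]`. -/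
def edgeXZ (σ : ℝ) (t : ℝ) : E3 := !₂[cos t, 0, σ * sin t]

/-- Exterior dihedral angle at a point `p` of `edgeXY τ`: the angle between the exterior normals of
the two faces (upper and lower) that meet there. -/
def dihedralXY (τ : ℝ) (p : E3) : ℝ :=
  InnerProductGeometry.angle (faceNormal 1 τ (p 0) (p 1)) (faceNormal (-1) τ (p 0) (p 1))

/-- Exterior dihedral angle at a point `p` of `edgeXZ σ`: the angle between the exterior normals of
the two faces (`y ≥ 0` and `y ≤ 0`) that meet there. -/
def dihedralXZ (σ : ℝ) (p : E3) : ℝ :=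
  InnerProductGeometry.angle (faceNormal σ 1 (p 0) (p 1)) (faceNormal σ (-1) (p 0) (p 1))

/-- The integrand `α ds` of a function `α` along a parametrised curve `γ`. -/
def arcIntegrand (α : E3 → ℝ) (γ : ℝ → E3) (t : ℝ) : ℝ := α (γ t) * ‖deriv γ t‖

/-- `∫_{∂Ω} H dS`, the sum over the four faces. -/
def totalMeanCurvature : ℝ :=
  ∑ σ ∈ ({1, -1} : Finset ℝ), ∑ τ ∈ ({1, -1} : Finset ℝ),
    ∫ q in faceDomain τ, faceIntegrand σ τ q

/-- `∑ⱼ ∫_{εⱼ} αⱼ ds`, the sum over the four edges. -/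
def totalDihedral : ℝ :=
  (∑ τ ∈ ({1, -1} : Finset ℝ), ∫ t in (0 : ℝ)..π, arcIntegrand (dihedralXY τ) (edgeXY τ) t)
    + ∑ σ ∈ ({1, -1} : Finset ℝ), ∫ t in (0 : ℝ)..π, arcIntegrand (dihedralXZ σ) (edgeXZ σ) t

end TwoDisks

end

open TwoDisks

/-! The support function of a convex hull is the maximum of the support functions, so the width of
the body at `v = (a, b, c)` is `2 max (√(a² + b²), √(a² + c²))`. Spherical coordinates on `S²` come
from two successive polar changes of variables in `ℝ³` and the polar decomposition of Lebesgue
measure that defines the surface measure (`lintegral_toSphere_eq`). Invariance under the exchange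
of `b` and `c` (`lintegral_toSphere_comp_isometry`) replaces the maximum by its first entry on the
sector `b² ≥ c²` (`meanWidth_body_eq_sector`), and the inner integral is then elementary:
`MW = (2 / π) (∫_0^π arctan (sin θ) dθ + ∫_{-1}^1 dx / (2 - x²))` (`meanWidth_body_eq_arctan`).

The second integral is a logarithm. For the first, with `q = √2 - 1`, so that `2 q / (1 - q²) = 1`,
the function `arctan (sin θ)` is the sum of the values at `θ` and `π - θ` of
`arctan (q sin θ / (1 - q cos θ)) = ∑ qⁿ sin (n θ) / n`, the imaginary part of
`-log (1 - q e^{iθ})`; termwise integration gives the dilogarithms (`integral_arctan_eq_dilog`).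

The same two integrals are the two terms of the curvature formula. The body is
`|y| + |z| ≤ √(1 - x²)` (`mem_body_iff`); its faces are pieces of cylinders with
`H dS = dx dy / ((2 - x²) √(1 - x²))`, and along the edges the exterior angle is
`2 arccos (1 / √(2 - cos² t)) = 2 arctan (sin t)`, where `t` is the arc length parameter.

For the decimals, `(1 + q) / (1 - q) = 1 / q` turns the logarithm and the dilogarithms into one
series in odd powers of `q` (`hasSum_pi_mul_meanWidth_body`), whose partial sums are compared with
`π`, computed from Machin's formula. -/

/-! ### The body, its boundary and its support function -/

theorem convex_abs_add_abs_le_sqrt :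
    Convex ℝ {p : E3 | |p 1| + |p 2| ≤ √(1 - p 0 ^ 2) ∧ p 0 ^ 2 ≤ 1} := by
  rintro p ⟨hp, hp'⟩ q ⟨hq, hq'⟩ a b ha hb hab
  have hs : √(1 - p 0 ^ 2) ^ 2 = 1 - p 0 ^ 2 := sq_sqrt (by linarith)
  have ht : √(1 - q 0 ^ 2) ^ 2 = 1 - q 0 ^ 2 := sq_sqrt (by linarith)
  set s := √(1 - p 0 ^ 2)
  set t := √(1 - q 0 ^ 2)
  have key : (a * p 0 + b * q 0) ^ 2 + (a * s + b * t) ^ 2 ≤ 1 := by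
    have h1 : p 0 * q 0 + s * t ≤ 1 := by nlinarith [sq_nonneg (p 0 - q 0), sq_nonneg (s - t)]
    have h2 : 0 ≤ a * b := mul_nonneg ha hb
    have h3 : (a + b) ^ 2 = 1 := by rw [hab]; norm_num
    linear_combination a ^ 2 * hs + b ^ 2 * ht + 2 * mul_le_mul_of_nonneg_left h1 h2 + h3
  refine ⟨?_, ?_⟩
  · simp only [PiLp.add_apply, PiLp.smul_apply, smul_eq_mul]
    refine le_trans ?_ (Real.le_sqrt_of_sq_le (x := a * s + b * t) (by linarith))
    have h1 := abs_add_le (a * p 1) (b * q 1)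
    have h2 := abs_add_le (a * p 2) (b * q 2)
    simp only [abs_mul, abs_of_nonneg ha, abs_of_nonneg hb] at h1 h2
    nlinarith [mul_le_mul_of_nonneg_left hp ha, mul_le_mul_of_nonneg_left hq hb]
  · simp only [PiLp.add_apply, PiLp.smul_apply, smul_eq_mul]
    nlinarith [sq_nonneg (a * s + b * t)]

/-- Every slice of the body by a plane `x = const` is a square with diagonals in the two disks. -/
theorem mem_body_iff {p : E3} :
    p ∈ Ω ↔ |p 1| + |p 2| ≤ √(1 - p 0 ^ 2) ∧ p 0 ^ 2 ≤ 1 := by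
  constructor
  · intro hp
    refine convexHull_min (t := {p : E3 | |p 1| + |p 2| ≤ √(1 - p 0 ^ 2) ∧ p 0 ^ 2 ≤ 1})
      ?_ convex_abs_add_abs_le_sqrt hp
    rintro q (⟨hq, hq'⟩ | ⟨hq, hq'⟩)
    · refine ⟨?_, by nlinarith [sq_nonneg (q 1)]⟩
      rw [hq', abs_zero, add_zero]
      exact Real.abs_le_sqrt (by linarith)
    · refine ⟨?_, by nlinarith [sq_nonneg (q 2)]⟩
      rw [hq', abs_zero, zero_add]
      exact Real.abs_le_sqrt (by linarith)
  · rintro ⟨hp, hp'⟩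
    have hs : √(1 - p 0 ^ 2) ^ 2 = 1 - p 0 ^ 2 := sq_sqrt (by linarith)
    have h0 : 0 ≤ |p 1| := abs_nonneg _
    have h0' : 0 ≤ |p 2| := abs_nonneg _
    have hm2 : (|p 1| + |p 2|) ^ 2 ≤ 1 - p 0 ^ 2 := by
      rw [← hs]; exact pow_le_pow_left₀ (by positivity) hp 2
    rcases (add_nonneg h0 h0').eq_or_lt with hm | hm
    · refine subset_convexHull ℝ _ (Or.inl ⟨?_, ?_⟩)
      · have : p 1 = 0 := abs_eq_zero.1 (by linarith)
        rw [this]; linarith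
      · exact abs_eq_zero.1 (by linarith)
    -- `p` divides the segment between two points of the disks at the same height `x`
    · set m := |p 1| + |p 2| with hmdef
      have hne : m ≠ 0 := hm.ne'
      have hA : (!₂[p 0, SignType.sign (p 1) * m, 0] : E3) ∈ diskXY ∪ diskXZ := by
        left
        refine ⟨?_, by simp⟩
        rcases lt_trichotomy (p 1) 0 with h | h | h <;>
          simp [h, -sq_le_one_iff_abs_le_one] <;> nlinarith
      have hB : (!₂[p 0, 0, SignType.sign (p 2) * m] : E3) ∈ diskXY ∪ diskXZ := by
        right
        refine ⟨?_, by simp⟩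
        rcases lt_trichotomy (p 2) 0 with h | h | h <;>
          simp [h, -sq_le_one_iff_abs_le_one] <;> nlinarith
      have := (convex_convexHull ℝ (diskXY ∪ diskXZ)) (subset_convexHull ℝ _ hA)
        (subset_convexHull ℝ _ hB) (a := |p 1| / m) (b := |p 2| / m) (by positivity)
        (by positivity) (by rw [← add_div, ← hmdef, div_self hne])
      change p ∈ convexHull ℝ (diskXY ∪ diskXZ)
      convert this using 1
      ext i
      fin_cases i
      · simp only [Fin.zero_eta, PiLp.add_apply, PiLp.smul_apply, smul_eq_mul,
          Matrix.cons_val_zero]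
        rw [← add_mul, ← add_div, ← hmdef, div_self hne, one_mul]
      · have := sign_mul_abs (p 1)
        simp
        field_simp
        linarith
      · have := sign_mul_abs (p 2)
        simp
        field_simp
        linarith

theorem isClosed_body : IsClosed (Ω : Set E3) := by
  have : (Ω : Set E3) = {p : E3 | |p 1| + |p 2| ≤ √(1 - p 0 ^ 2)} ∩ {p : E3 | p 0 ^ 2 ≤ 1} := by
    ext p; exact mem_body_iff
  rw [this]
  exact (isClosed_le (by fun_prop) (by fun_prop)).inter (isClosed_le (by fun_prop) (by fun_prop))

theorem mem_interior_body_iff {p : E3} :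
    p ∈ interior Ω ↔ |p 1| + |p 2| < √(1 - p 0 ^ 2) := by
  constructor
  · intro hp
    -- scaling by a factor `t > 1` moves a point with equality out of the body
    by_contra! hlt
    have hpΩ := mem_body_iff.1 (interior_subset hp)
    have heq := le_antisymm hpΩ.1 hlt
    have hmem : ∀ᶠ t : ℝ in nhds 1, t • p ∈ Ω := by
      have hc : ContinuousAt (fun t : ℝ => t • p) 1 := by fun_prop
      exact hc (by simpa using mem_interior_iff_mem_nhds.1 hp)
    obtain ⟨t, ht, ht1⟩ := ((hmem.filter_mono nhdsWithin_le_nhds).and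
      (self_mem_nhdsWithin : Set.Ioi (1 : ℝ) ∈ nhdsWithin 1 (Set.Ioi 1))).exists
    have ht1 : 1 < t := ht1
    obtain ⟨h1, h2⟩ := mem_body_iff.1 ht
    simp only [PiLp.smul_apply, smul_eq_mul, abs_mul, abs_of_pos (zero_lt_one.trans ht1)] at h1 h2
    have h3 := pow_le_pow_left₀ (by positivity) h1 2
    rw [sq_sqrt (by linarith), ← mul_add, heq, mul_pow, sq_sqrt (by linarith [hpΩ.2])] at h3
    nlinarith
  · intro hp
    have ho : IsOpen {p : E3 | |p 1| + |p 2| < √(1 - p 0 ^ 2)} :=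
      isOpen_lt (by fun_prop) (by fun_prop)
    refine interior_maximal ?_ ho hp
    intro q hq
    have hq' : |q 1| + |q 2| < √(1 - q 0 ^ 2) := hq
    refine mem_body_iff.2 ⟨hq'.le, ?_⟩
    have : 0 < √(1 - q 0 ^ 2) := lt_of_le_of_lt (by positivity) hq'
    linarith [Real.sqrt_pos.1 this]

theorem frontier_body :
    frontier Ω = {p : E3 | p 0 ^ 2 + p 1 ^ 2 ≤ 1 ∧
      (p 2 = √(1 - p 0 ^ 2) - |p 1| ∨ p 2 = -(√(1 - p 0 ^ 2) - |p 1|))} := by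
  ext p
  rw [isClosed_body.frontier_eq, Set.mem_sdiff, mem_body_iff, mem_interior_body_iff, not_lt]
  constructor
  · rintro ⟨⟨h1, h2⟩, h3⟩
    have h4 : |p 2| = √(1 - p 0 ^ 2) - |p 1| := by linarith
    refine ⟨?_, ?_⟩
    · have h5 : |p 1| ≤ √(1 - p 0 ^ 2) := by linarith [abs_nonneg (p 2)]
      have h6 := pow_le_pow_left₀ (abs_nonneg _) h5 2
      rw [sq_sqrt (by linarith), sq_abs] at h6
      linarith
    · rw [← h4]
      exact (abs_choice (p 2)).elim (fun h => Or.inl h.symm) (fun h => Or.inr (by linarith))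
  · rintro ⟨h1, h2⟩
    have h3 : |p 1| ≤ √(1 - p 0 ^ 2) := Real.abs_le_sqrt (by linarith)
    have h4 : |p 2| = √(1 - p 0 ^ 2) - |p 1| := by
      rcases h2 with h2 | h2 <;> rw [h2]
      · exact abs_of_nonneg (by linarith)
      · rw [abs_neg]; exact abs_of_nonneg (by linarith)
    exact ⟨⟨by linarith, by nlinarith [sq_nonneg (p 1)]⟩, by linarith⟩

theorem inner_E3 (v p : E3) : inner ℝ v p = v 0 * p 0 + v 1 * p 1 + v 2 * p 2 := by
  simp [PiLp.inner_apply, Fin.sum_univ_three, mul_comm]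

theorem mul_add_mul_le_sqrt {a b x y : ℝ} (h : x ^ 2 + y ^ 2 ≤ 1) :
    a * x + b * y ≤ √(a ^ 2 + b ^ 2) := by
  refine Real.le_sqrt_of_sq_le ?_
  nlinarith [sq_nonneg (a * y - b * x), mul_nonneg (add_nonneg (sq_nonneg a) (sq_nonneg b))
    (sub_nonneg.2 h)]

theorem exists_unit_mul_add_mul_eq_sqrt (a b : ℝ) :
    ∃ x y : ℝ, x ^ 2 + y ^ 2 ≤ 1 ∧ a * x + b * y = √(a ^ 2 + b ^ 2) := by
  have h0 : 0 ≤ a ^ 2 + b ^ 2 := by positivity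
  rcases h0.eq_or_lt with h | h
  · refine ⟨0, 0, by norm_num, ?_⟩
    rw [← h]; simp
  · have hs := Real.sqrt_pos.2 h
    have hs2 := Real.sq_sqrt h0
    refine ⟨a / √(a ^ 2 + b ^ 2), b / √(a ^ 2 + b ^ 2), ?_, ?_⟩
    · rw [div_pow, div_pow, ← add_div, hs2, div_self h.ne']
    · field_simp
      rw [hs2]

theorem isGreatest_diskXY (v : E3) :
    IsGreatest ((fun x : E3 => inner ℝ v x) '' diskXY) √(v 0 ^ 2 + v 1 ^ 2) := by
  constructor
  · obtain ⟨x, y, h, h'⟩ := exists_unit_mul_add_mul_eq_sqrt (v 0) (v 1)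
    exact ⟨!₂[x, y, 0], ⟨by simpa using h, by simp⟩, by simp [inner_E3, ← h']⟩
  · rintro _ ⟨p, ⟨h, h'⟩, rfl⟩
    simpa [inner_E3, h'] using mul_add_mul_le_sqrt (a := v 0) (b := v 1) h

theorem isGreatest_diskXZ (v : E3) :
    IsGreatest ((fun x : E3 => inner ℝ v x) '' diskXZ) √(v 0 ^ 2 + v 2 ^ 2) := by
  constructor
  · obtain ⟨x, y, h, h'⟩ := exists_unit_mul_add_mul_eq_sqrt (v 0) (v 2)
    exact ⟨!₂[x, 0, y], ⟨by simpa using h, by simp⟩, by simp [inner_E3, ← h']⟩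
  · rintro _ ⟨p, ⟨h, h'⟩, rfl⟩
    simpa [inner_E3, h'] using mul_add_mul_le_sqrt (a := v 0) (b := v 2) h

theorem isGreatest_body (v : E3) :
    IsGreatest ((fun x : E3 => inner ℝ v x) '' Ω)
      (max √(v 0 ^ 2 + v 1 ^ 2) √(v 0 ^ 2 + v 2 ^ 2)) := by
  constructor
  · have hsub : diskXY ∪ diskXZ ⊆ Ω := subset_convexHull ℝ _
    rcases max_choice √(v 0 ^ 2 + v 1 ^ 2) √(v 0 ^ 2 + v 2 ^ 2) with h | h <;> rw [h]
    · exact Set.image_mono (Set.subset_union_left.trans hsub) (isGreatest_diskXY v).1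
    · exact Set.image_mono (Set.subset_union_right.trans hsub) (isGreatest_diskXZ v).1
  · rintro _ ⟨p, hp, rfl⟩
    refine convexHull_min (t := {x : E3 | inner ℝ v x ≤ max √(v 0 ^ 2 + v 1 ^ 2)
      √(v 0 ^ 2 + v 2 ^ 2)}) ?_ ?_ hp
    · rintro q (hq | hq)
      · exact ((isGreatest_diskXY v).2 ⟨q, hq, rfl⟩).trans (le_max_left _ _)
      · exact ((isGreatest_diskXZ v).2 ⟨q, hq, rfl⟩).trans (le_max_right _ _)
    · exact convex_halfSpace_le (innerₗ E3 v).isLinear _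

theorem supportFun_diskXY (v : E3) : supportFun diskXY v = √(v 0 ^ 2 + v 1 ^ 2) :=
  (isGreatest_diskXY v).csSup_eq

theorem supportFun_diskXZ (v : E3) : supportFun diskXZ v = √(v 0 ^ 2 + v 2 ^ 2) :=
  (isGreatest_diskXZ v).csSup_eq

theorem supportFun_body (v : E3) :
    supportFun Ω v = max √(v 0 ^ 2 + v 1 ^ 2) √(v 0 ^ 2 + v 2 ^ 2) :=
  (isGreatest_body v).csSup_eq

theorem width_body (v : E3) :
    width Ω v = 2 * max √(v 0 ^ 2 + v 1 ^ 2) √(v 0 ^ 2 + v 2 ^ 2) := by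
  simp [width, supportFun_body, two_mul]

/-! ### Derivatives of the faces, normals and mean curvature -/

theorem dy_faceFun (σ τ x y : ℝ) : dy (faceFun σ τ) x y = -(σ * τ) := by
  have h : HasDerivAt (fun t => faceFun σ τ x t) (σ * (0 - τ * 1)) y :=
    (((hasDerivAt_const y _).sub ((hasDerivAt_id y).const_mul τ))).const_mul σ
  rw [dy, h.deriv]; ring

theorem hasDerivAt_sqrt_one_sub_sq {x : ℝ} (hx : x ^ 2 < 1) :
    HasDerivAt (fun t : ℝ => √(1 - t ^ 2)) (-x / √(1 - x ^ 2)) x := by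
  have h : HasDerivAt (fun t : ℝ => 1 - t ^ 2) (-(2 * x)) x := by
    simpa using ((hasDerivAt_pow 2 x).const_sub 1)
  convert h.sqrt (by linarith) using 1
  rw [neg_div, neg_div, mul_div_mul_left _ _ two_ne_zero]

theorem dx_faceFun {σ τ x : ℝ} (y : ℝ) (hx : x ^ 2 < 1) :
    dx (faceFun σ τ) x y = -(σ * x / √(1 - x ^ 2)) := by
  have h : HasDerivAt (fun t => faceFun σ τ t y) (σ * (-x / √(1 - x ^ 2))) x :=
    ((hasDerivAt_sqrt_one_sub_sq hx).sub_const (τ * y)).const_mul σ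
  rw [dx, h.deriv]; ring

theorem dy_dy_faceFun (σ τ x y : ℝ) : dy (dy (faceFun σ τ)) x y = 0 := by
  have : (fun t => dy (faceFun σ τ) x t) = fun _ => -(σ * τ) := funext fun t => dy_faceFun σ τ x t
  rw [dy, this, deriv_const]

theorem dy_dx_faceFun {σ τ x : ℝ} (y : ℝ) (hx : x ^ 2 < 1) :
    dy (dx (faceFun σ τ)) x y = 0 := by
  have : (fun t => dx (faceFun σ τ) x t) = fun _ => -(σ * x / √(1 - x ^ 2)) :=
    funext fun t => dx_faceFun t hx
  rw [dy, this, deriv_const]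

theorem dx_dx_faceFun {σ τ x : ℝ} (y : ℝ) (hx : x ^ 2 < 1) :
    dx (dx (faceFun σ τ)) x y = -(σ / √(1 - x ^ 2) ^ 3) := by
  have hs : 0 < √(1 - x ^ 2) := Real.sqrt_pos.2 (by linarith)
  have hs2 : √(1 - x ^ 2) ^ 2 = 1 - x ^ 2 := sq_sqrt (by linarith)
  have hev : (fun t => dx (faceFun σ τ) t y) =ᶠ[nhds x] fun t => -(σ * t / √(1 - t ^ 2)) := by
    have ho : IsOpen {t : ℝ | t ^ 2 < 1} := isOpen_lt (by fun_prop) (by fun_prop)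
    filter_upwards [ho.mem_nhds hx] with t ht using dx_faceFun y ht
  have h := ((((hasDerivAt_id x).const_mul σ).div (hasDerivAt_sqrt_one_sub_sq hx) hs.ne').neg)
  rw [dx, hev.deriv_eq]
  refine h.deriv.trans ?_
  simp only [id]
  field_simp
  rw [hs2]; ring

theorem sign_sq {σ : ℝ} (hσ : σ ∈ ({1, -1} : Set ℝ)) : σ ^ 2 = 1 := by
  rcases hσ with rfl | rfl <;> norm_num

theorem areaDensity_faceFun {σ τ x : ℝ} (hσ : σ ∈ ({1, -1} : Set ℝ)) (hτ : τ ∈ ({1, -1} : Set ℝ))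
    (y : ℝ) (hx : x ^ 2 < 1) :
    areaDensity (faceFun σ τ) x y = √(2 - x ^ 2) / √(1 - x ^ 2) := by
  have hs : 0 < 1 - x ^ 2 := by linarith
  have hs2 : √(1 - x ^ 2) ^ 2 = 1 - x ^ 2 := sq_sqrt hs.le
  rw [areaDensity, dx_faceFun y hx, dy_faceFun, ← Real.sqrt_div (by linarith)]
  congr 1
  rw [neg_sq, neg_sq, div_pow, mul_pow, mul_pow, sign_sq hσ, sign_sq hτ, hs2]
  field_simp
  ring

/-- The exterior normal is constant on the rulings `x = const` of the face. -/
theorem faceNormal_eq {σ τ x : ℝ} (hσ : σ ∈ ({1, -1} : Set ℝ)) (hτ : τ ∈ ({1, -1} : Set ℝ))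
    (y : ℝ) (hx : x ^ 2 < 1) :
    faceNormal σ τ x y =
      (√(1 - x ^ 2) / √(2 - x ^ 2)) • (!₂[x / √(1 - x ^ 2), τ, σ] : E3) := by
  have h2 := sign_sq hσ
  rw [faceNormal, upNormal, areaDensity_faceFun hσ hτ y hx, dx_faceFun y hx, dy_faceFun,
    smul_comm, one_div_div]
  congr 1
  ext i
  fin_cases i
  · simp
    linear_combination (x / √(1 - x ^ 2)) * h2
  · simp
    linear_combination τ * h2
  · simp

theorem norm_faceNormal {σ τ x : ℝ} (hσ : σ ∈ ({1, -1} : Set ℝ)) (hτ : τ ∈ ({1, -1} : Set ℝ))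
    (y : ℝ) (hx : x ^ 2 < 1) : ‖faceNormal σ τ x y‖ = 1 := by
  have hs : 0 < 1 - x ^ 2 := by linarith
  have hs2 : √(1 - x ^ 2) ^ 2 = 1 - x ^ 2 := sq_sqrt hs.le
  have ht2 : √(2 - x ^ 2) ^ 2 = 2 - x ^ 2 := sq_sqrt (by linarith)
  have ht : 2 - x ^ 2 ≠ 0 := by linarith
  have hs' : 0 < √(1 - x ^ 2) := Real.sqrt_pos.2 hs
  rw [← sq_eq_sq₀ (norm_nonneg _) zero_le_one, ← real_inner_self_eq_norm_sq,
    faceNormal_eq hσ hτ y hx, real_inner_smul_left, real_inner_smul_right, inner_E3]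
  simp only [Matrix.cons_val_zero, Matrix.cons_val_one, Matrix.cons_val]
  have hsum : x / √(1 - x ^ 2) * (x / √(1 - x ^ 2)) + τ * τ + σ * σ
      = (2 - x ^ 2) / (1 - x ^ 2) := by
    rw [← sq, ← sq, ← sq, sign_sq hσ, sign_sq hτ, div_pow, hs2]
    field_simp
    ring
  rw [hsum, ← mul_assoc, ← sq, div_pow, hs2, ht2]
  field_simp

theorem inner_faceNormal_sub_le {σ τ x y : ℝ} (hσ : σ ∈ ({1, -1} : Set ℝ))
    (hτ : τ ∈ ({1, -1} : Set ℝ)) (hx : x ^ 2 < 1) {q : E3} (hq : q ∈ Ω) :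
    inner ℝ (faceNormal σ τ x y) (q - !₂[x, y, faceFun σ τ x y]) ≤ 0 := by
  have hs : 0 < 1 - x ^ 2 := by linarith
  have hs2 : √(1 - x ^ 2) ^ 2 = 1 - x ^ 2 := sq_sqrt hs.le
  have hs' : 0 < √(1 - x ^ 2) := Real.sqrt_pos.2 hs
  obtain ⟨h1, h2⟩ := mem_body_iff.1 hq
  rw [faceNormal_eq hσ hτ y hx, real_inner_smul_left, inner_E3]
  refine mul_nonpos_of_nonneg_of_nonpos (by positivity) ?_
  have hr2 : √(1 - q 0 ^ 2) ^ 2 = 1 - q 0 ^ 2 := sq_sqrt (by linarith)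
  have h3 : τ * q 1 ≤ |q 1| := by
    rcases hτ with rfl | rfl
    · rw [one_mul]; exact le_abs_self _
    · rw [neg_one_mul]; exact neg_le_abs _
  have h4 : σ * q 2 ≤ |q 2| := by
    rcases hσ with rfl | rfl
    · rw [one_mul]; exact le_abs_self _
    · rw [neg_one_mul]; exact neg_le_abs _
  -- Cauchy-Schwarz in the plane for `(x, √(1 - x²))` and `(q₀, √(1 - q₀²))`
  have h5 : x * q 0 + √(1 - x ^ 2) * √(1 - q 0 ^ 2) ≤ 1 := by
    nlinarith [sq_nonneg (x - q 0), sq_nonneg (√(1 - x ^ 2) - √(1 - q 0 ^ 2))]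
  simp only [PiLp.sub_apply, Matrix.cons_val_zero, Matrix.cons_val_one,
    Matrix.cons_val, faceFun]
  set s := √(1 - x ^ 2)
  have h6 : x / s * (q 0 - x) + τ * (q 1 - y) + σ * (q 2 - σ * (s - τ * y))
      = x / s * q 0 - x ^ 2 / s - s + τ * q 1 + σ * q 2 := by
    linear_combination (τ * y - s) * sign_sq hσ
  have h7 : x / s * q 0 - x ^ 2 / s - s = (x * q 0 - 1) / s := by
    field_simp
    rw [hs2]; ring
  have h8 : (x * q 0 - 1) / s ≤ -√(1 - q 0 ^ 2) := by
    rw [div_le_iff₀ hs']; linarith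
  rw [h6, h7]
  linarith

/-- The curvature density `H dS / (dx dy)` in the coordinates `(x, y)`. -/
theorem faceIntegrand_eq {σ τ : ℝ} (hσ : σ ∈ ({1, -1} : Set ℝ)) (hτ : τ ∈ ({1, -1} : Set ℝ))
    {q : ℝ × ℝ} (hq : q.1 ^ 2 < 1) :
    faceIntegrand σ τ q = 1 / ((2 - q.1 ^ 2) * √(1 - q.1 ^ 2)) := by
  obtain ⟨x, y⟩ := q
  simp only at hq ⊢
  have hs : 0 < 1 - x ^ 2 := by linarith
  have hs' : 0 < √(1 - x ^ 2) := Real.sqrt_pos.2 hs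
  have ht : 0 < 2 - x ^ 2 := by linarith
  have hA := areaDensity_faceFun hσ hτ y hq
  -- with `A` the area density, the denominator of the mean curvature is `2 A³`
  have hpow : (1 + dx (faceFun σ τ) x y ^ 2 + dy (faceFun σ τ) x y ^ 2) ^ ((3 : ℝ) / 2)
      = (√(2 - x ^ 2) / √(1 - x ^ 2)) ^ 3 := by
    rw [← hA, areaDensity]
    generalize hD : 1 + dx (faceFun σ τ) x y ^ 2 + dy (faceFun σ τ) x y ^ 2 = D
    have hD0 : 0 ≤ D := by rw [← hD]; positivity
    rw [Real.sqrt_eq_rpow, ← Real.rpow_mul_natCast hD0]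
    norm_num
  have ht2 : √(2 - x ^ 2) ^ 2 = 2 - x ^ 2 := sq_sqrt ht.le
  have ht' : 0 < √(2 - x ^ 2) := Real.sqrt_pos.2 ht
  rw [faceIntegrand, faceMeanCurvature, graphMeanCurvature, hpow, hA, dy_dy_faceFun,
    dy_dx_faceFun y hq, dx_dx_faceFun y hq, dy_faceFun, neg_sq, mul_pow, sign_sq hσ, sign_sq hτ]
  have hσ2 := sign_sq hσ
  set s := √(1 - x ^ 2)
  set t := √(2 - x ^ 2)
  rw [← ht2]
  field_simp
  linear_combination (2 : ℝ) * hσ2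

theorem hasDerivAt_toLp_three {f g h : ℝ → ℝ} {f' g' h' t : ℝ} (hf : HasDerivAt f f' t)
    (hg : HasDerivAt g g' t) (hh : HasDerivAt h h' t) :
    HasDerivAt (fun t => (!₂[f t, g t, h t] : E3)) !₂[f', g', h'] t := by
  have hpi : HasDerivAt (fun t => (![f t, g t, h t] : Fin 3 → ℝ)) ![f', g', h'] t := by
    rw [hasDerivAt_pi]
    intro i
    fin_cases i
    exacts [hf, hg, hh]
  exact ((PiLp.continuousLinearEquiv 2 ℝ
    (fun _ : Fin 3 => ℝ)).symm.hasFDerivAt.comp_hasDerivAt t hpi)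

theorem norm_deriv_edgeXY {τ : ℝ} (hτ : τ ∈ ({1, -1} : Set ℝ)) (t : ℝ) :
    ‖deriv (edgeXY τ) t‖ = 1 := by
  have h := hasDerivAt_toLp_three (hasDerivAt_cos t) ((hasDerivAt_sin t).const_mul τ)
    (hasDerivAt_const t (0 : ℝ))
  rw [show edgeXY τ = fun t => !₂[cos t, τ * sin t, 0] from rfl, h.deriv,
    ← sq_eq_sq₀ (norm_nonneg _) zero_le_one, ← real_inner_self_eq_norm_sq, inner_E3]
  simp
  linear_combination (cos t ^ 2) * sign_sq hτ + sin_sq_add_cos_sq t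

theorem norm_deriv_edgeXZ {σ : ℝ} (hσ : σ ∈ ({1, -1} : Set ℝ)) (t : ℝ) :
    ‖deriv (edgeXZ σ) t‖ = 1 := by
  have h := hasDerivAt_toLp_three (hasDerivAt_cos t) (hasDerivAt_const t (0 : ℝ))
    ((hasDerivAt_sin t).const_mul σ)
  rw [show edgeXZ σ = fun t => !₂[cos t, 0, σ * sin t] from rfl, h.deriv,
    ← sq_eq_sq₀ (norm_nonneg _) zero_le_one, ← real_inner_self_eq_norm_sq, inner_E3]
  simp
  linear_combination (cos t ^ 2) * sign_sq hσ + sin_sq_add_cos_sq t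

/-- The half-angle form `arccos (x² / (2 - x²)) = 2 arccos (1 / √(2 - x²))`. -/
theorem arccos_eq_two_mul_arccos {x : ℝ} (hx : x ^ 2 < 1) :
    arccos (x ^ 2 / (2 - x ^ 2)) = 2 * arccos (1 / √(2 - x ^ 2)) := by
  have ht : 0 < 2 - x ^ 2 := by linarith
  have ht2 : √(2 - x ^ 2) ^ 2 = 2 - x ^ 2 := sq_sqrt ht.le
  have ht1 : 1 ≤ √(2 - x ^ 2) := Real.le_sqrt_of_sq_le (by linarith)
  have hle : 1 / √(2 - x ^ 2) ≤ 1 := (div_le_one (by linarith)).2 ht1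
  have hnn : 0 ≤ 1 / √(2 - x ^ 2) := by positivity
  have hcos : cos (2 * arccos (1 / √(2 - x ^ 2))) = x ^ 2 / (2 - x ^ 2) := by
    rw [cos_two_mul, cos_arccos (by linarith) hle, div_pow, ht2]
    field_simp
    ring
  rw [← hcos, arccos_cos]
  · exact mul_nonneg zero_le_two (arccos_nonneg _)
  · linarith [arccos_le_pi_div_two.2 hnn]

/-- Two faces whose sign pairs differ in exactly one entry meet at the same exterior angle. -/
theorem angle_faceNormal {σ τ σ' τ' x : ℝ} (hσ : σ ∈ ({1, -1} : Set ℝ))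
    (hτ : τ ∈ ({1, -1} : Set ℝ)) (hσ' : σ' ∈ ({1, -1} : Set ℝ)) (hτ' : τ' ∈ ({1, -1} : Set ℝ))
    (h : σ * σ' + τ * τ' = 0) (y : ℝ) (hx : x ^ 2 < 1) :
    InnerProductGeometry.angle (faceNormal σ τ x y) (faceNormal σ' τ' x y)
      = 2 * arccos (1 / √(2 - x ^ 2)) := by
  have hs : 0 < 1 - x ^ 2 := by linarith
  have hs2 : √(1 - x ^ 2) ^ 2 = 1 - x ^ 2 := sq_sqrt hs.le
  have ht2 : √(2 - x ^ 2) ^ 2 = 2 - x ^ 2 := sq_sqrt (by linarith)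
  have ht : 2 - x ^ 2 ≠ 0 := by linarith
  rw [← arccos_eq_two_mul_arccos hx, InnerProductGeometry.angle, norm_faceNormal hσ hτ y hx,
    norm_faceNormal hσ' hτ' y hx, mul_one, div_one, faceNormal_eq hσ hτ y hx,
    faceNormal_eq hσ' hτ' y hx, real_inner_smul_left, real_inner_smul_right, inner_E3]
  simp only [Matrix.cons_val_zero, Matrix.cons_val_one, Matrix.cons_val]
  congr 1
  have hsum : x / √(1 - x ^ 2) * (x / √(1 - x ^ 2)) + τ * τ' + σ * σ' = x ^ 2 / (1 - x ^ 2) := by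
    have hxs : x / √(1 - x ^ 2) * (x / √(1 - x ^ 2)) = x ^ 2 / (1 - x ^ 2) := by
      rw [← sq, div_pow, hs2]
    linear_combination h + hxs
  rw [hsum, ← mul_assoc, ← sq, div_pow, hs2, ht2]
  field_simp

/-! ### Integration of the mean curvature and of the dihedral angles -/

theorem sq_cos_lt_one {t : ℝ} (ht : t ∈ Set.Ioo 0 π) : cos t ^ 2 < 1 := by
  have := sin_pos_of_mem_Ioo ht
  nlinarith [sin_sq_add_cos_sq t]

theorem arcIntegrand_edgeXY {τ : ℝ} (hτ : τ ∈ ({1, -1} : Set ℝ)) {t : ℝ}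
    (ht : t ∈ Set.Ioo 0 π) :
    arcIntegrand (dihedralXY τ) (edgeXY τ) t = 2 * arccos (1 / √(2 - cos t ^ 2)) := by
  rw [arcIntegrand, norm_deriv_edgeXY hτ, mul_one, dihedralXY,
    angle_faceNormal (by simp) hτ (by simp) hτ (by nlinarith [sign_sq hτ]) _
      (by simpa [edgeXY] using sq_cos_lt_one ht)]
  simp [edgeXY]

theorem arcIntegrand_edgeXZ {σ : ℝ} (hσ : σ ∈ ({1, -1} : Set ℝ)) {t : ℝ}
    (ht : t ∈ Set.Ioo 0 π) :
    arcIntegrand (dihedralXZ σ) (edgeXZ σ) t = 2 * arccos (1 / √(2 - cos t ^ 2)) := by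
  rw [arcIntegrand, norm_deriv_edgeXZ hσ, mul_one, dihedralXZ,
    angle_faceNormal hσ (by simp) hσ (by simp) (by nlinarith [sign_sq hσ]) _
      (by simpa [edgeXZ] using sq_cos_lt_one ht)]
  simp [edgeXZ]

theorem intervalIntegrable_and_integral_of_eqOn_Ioo {f g : ℝ → ℝ} {a b : ℝ} (hab : a ≤ b)
    (hg : IntervalIntegrable g volume a b) (h : Set.EqOn f g (Set.Ioo a b)) :
    IntervalIntegrable f volume a b ∧ ∫ t in a..b, f t = ∫ t in a..b, g t := by
  have hae : f =ᵐ[volume.restrict (Set.Ioc a b)] g := by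
    rw [← Measure.restrict_congr_set (Ioo_ae_eq_Ioc (μ := volume) (a := a) (b := b))]
    filter_upwards [ae_restrict_mem measurableSet_Ioo] with t ht using h ht
  constructor
  · rw [intervalIntegrable_iff_integrableOn_Ioc_of_le hab] at hg ⊢
    exact hg.congr hae.symm
  · rw [intervalIntegral.integral_of_le hab, intervalIntegral.integral_of_le hab]
    exact integral_congr_ae hae

theorem continuous_dihedralAngle : Continuous fun t : ℝ => 2 * arccos (1 / √(2 - cos t ^ 2)) := by
  have h : ∀ t : ℝ, √(2 - cos t ^ 2) ≠ 0 := fun t =>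
    (Real.sqrt_pos.2 (by nlinarith [sin_sq_add_cos_sq t, sq_nonneg (sin t)])).ne'
  exact continuous_const.mul (continuous_arccos.comp
    (continuous_const.div (by fun_prop) h))

theorem edgeXY_integral {τ : ℝ} (hτ : τ ∈ ({1, -1} : Set ℝ)) :
    IntervalIntegrable (arcIntegrand (dihedralXY τ) (edgeXY τ)) volume 0 π ∧
      ∫ t in (0 : ℝ)..π, arcIntegrand (dihedralXY τ) (edgeXY τ) t =
        ∫ t in (0 : ℝ)..π, 2 * arccos (1 / √(2 - cos t ^ 2)) :=
  intervalIntegrable_and_integral_of_eqOn_Ioo pi_pos.le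
    (continuous_dihedralAngle.intervalIntegrable _ _) fun _ ht => arcIntegrand_edgeXY hτ ht

theorem edgeXZ_integral {σ : ℝ} (hσ : σ ∈ ({1, -1} : Set ℝ)) :
    IntervalIntegrable (arcIntegrand (dihedralXZ σ) (edgeXZ σ)) volume 0 π ∧
      ∫ t in (0 : ℝ)..π, arcIntegrand (dihedralXZ σ) (edgeXZ σ) t =
        ∫ t in (0 : ℝ)..π, 2 * arccos (1 / √(2 - cos t ^ 2)) :=
  intervalIntegrable_and_integral_of_eqOn_Ioo pi_pos.le
    (continuous_dihedralAngle.intervalIntegrable _ _) fun _ ht => arcIntegrand_edgeXZ hσ ht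

/-- All four edges contribute the same integral. -/
theorem totalDihedral_eq :
    totalDihedral = 8 * ∫ t in (0 : ℝ)..π, arccos (1 / √(2 - cos t ^ 2)) := by
  have hne : (1 : ℝ) ∉ ({-1} : Finset ℝ) := by norm_num
  rw [totalDihedral, Finset.sum_insert hne, Finset.sum_insert hne, Finset.sum_singleton,
    Finset.sum_singleton, (edgeXY_integral (by simp)).2, (edgeXY_integral (by simp)).2,
    (edgeXZ_integral (by simp)).2, (edgeXZ_integral (by simp)).2,
    intervalIntegral.integral_const_mul]
  ring

theorem measurableSet_faceDomain (τ : ℝ) : MeasurableSet (faceDomain τ) :=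
  (measurableSet_lt (f := fun q : ℝ × ℝ => q.1 ^ 2 + q.2 ^ 2) (g := fun _ => 1) (by fun_prop)
    (by fun_prop)).inter
    (measurableSet_lt (f := fun _ => 0) (g := fun q : ℝ × ℝ => τ * q.2) (by fun_prop) (by fun_prop))

theorem faceDomain_section {τ : ℝ} (hτ : τ ∈ ({1, -1} : Set ℝ)) (x : ℝ) :
    volume {y : ℝ | (x, y) ∈ faceDomain τ} = ENNReal.ofReal √(1 - x ^ 2) := by
  have habs : ∀ y : ℝ, x ^ 2 + y ^ 2 < 1 ↔ |y| < √(1 - x ^ 2) := fun y => by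
    rw [← Real.sqrt_sq_eq_abs, Real.sqrt_lt_sqrt_iff (sq_nonneg y)]
    constructor <;> intro h <;> linarith
  rcases hτ with rfl | rfl
  · have : {y : ℝ | (x, y) ∈ faceDomain 1} = Set.Ioo 0 √(1 - x ^ 2) := by
      ext y
      simp only [faceDomain, Set.mem_ofPred_eq, habs, abs_lt, one_mul, Set.mem_Ioo]
      constructor
      · rintro ⟨⟨_, h2⟩, h3⟩; exact ⟨h3, h2⟩
      · rintro ⟨h1, h2⟩; exact ⟨⟨by linarith, h2⟩, h1⟩
    rw [this, Real.volume_Ioo, sub_zero]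
  · have : {y : ℝ | (x, y) ∈ faceDomain (-1)} = Set.Ioo (-√(1 - x ^ 2)) 0 := by
      ext y
      simp only [faceDomain, Set.mem_ofPred_eq, habs, abs_lt, Set.mem_Ioo]
      constructor
      · rintro ⟨⟨h1, _⟩, h3⟩; exact ⟨h1, by linarith⟩
      · rintro ⟨h1, h2⟩; exact ⟨⟨h1, by linarith⟩, by linarith⟩
    rw [this, Real.volume_Ioo, zero_sub, neg_neg]

theorem continuousOn_one_div_two_sub_sq :
    ContinuousOn (fun x : ℝ => 1 / (2 - x ^ 2)) (Set.uIcc (-1) 1) := by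
  refine continuousOn_const.div (by fun_prop) fun x hx => ?_
  rw [Set.uIcc_of_le (by norm_num)] at hx
  nlinarith [hx.1, hx.2]

/-- The integrand depends on `x` only, and the section of the half disk over `x` has length
`√(1 - x²)`. -/
theorem integral_faceDomain {τ : ℝ} (hτ : τ ∈ ({1, -1} : Set ℝ)) :
    IntegrableOn (fun q : ℝ × ℝ => 1 / ((2 - q.1 ^ 2) * √(1 - q.1 ^ 2))) (faceDomain τ) ∧
      ∫ q in faceDomain τ, 1 / ((2 - q.1 ^ 2) * √(1 - q.1 ^ 2)) =
        ∫ x in (-1 : ℝ)..1, 1 / (2 - x ^ 2) := by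
  set g : ℝ → ℝ := fun x => 1 / ((2 - x ^ 2) * √(1 - x ^ 2)) with hg
  set F : ℝ × ℝ → ℝ := (faceDomain τ).indicator fun q => g q.1
  have hmeas : MeasurableSet (faceDomain τ) := measurableSet_faceDomain τ
  have hgm : Measurable g := by rw [hg]; fun_prop
  have hsec : ∀ x, MeasurableSet {y : ℝ | (x, y) ∈ faceDomain τ} := fun x =>
    measurable_prodMk_left hmeas
  have hFsec : ∀ x, (fun y => F (x, y)) = {y : ℝ | (x, y) ∈ faceDomain τ}.indicator
      fun _ => g x := fun x => rfl
  have hgs : ∀ x, √(1 - x ^ 2) * g x = (Set.Ioo (-1) 1).indicator (fun x => 1 / (2 - x ^ 2)) x := by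
    intro x
    by_cases hx : x ∈ Set.Ioo (-1 : ℝ) 1
    · have h1 : 0 < 1 - x ^ 2 := by nlinarith [hx.1, hx.2]
      have h2 := Real.sqrt_pos.2 h1
      rw [Set.indicator_of_mem hx, hg]
      field_simp
    · have : √(1 - x ^ 2) = 0 := Real.sqrt_eq_zero_of_nonpos (by
        rw [Set.mem_Ioo, not_and_or, not_lt, not_lt] at hx
        rcases hx with hx | hx <;> nlinarith)
      rw [Set.indicator_of_notMem hx, this, zero_mul]
  have hgnn : ∀ x, 0 ≤ √(1 - x ^ 2) * g x := by
    intro x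
    rw [hgs]
    refine Set.indicator_nonneg (fun y hy => ?_) x
    have : 0 < 2 - y ^ 2 := by nlinarith [hy.1, hy.2]
    positivity
  have hint : ∀ x, ∫ y, F (x, y) = √(1 - x ^ 2) * g x := fun x => by
    rw [hFsec, integral_indicator (hsec x), setIntegral_const, measureReal_def,
      faceDomain_section hτ, ENNReal.toReal_ofReal (Real.sqrt_nonneg _), smul_eq_mul]
  have hintn : ∀ x, ∫ y, ‖F (x, y)‖ = √(1 - x ^ 2) * g x := fun x => by
    have : (fun y => ‖F (x, y)‖) = {y : ℝ | (x, y) ∈ faceDomain τ}.indicator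
        fun _ => ‖g x‖ := by
      funext y
      exact norm_indicator_eq_indicator_norm _ _
    rw [this, integral_indicator (hsec x), setIntegral_const, measureReal_def,
      faceDomain_section hτ, ENNReal.toReal_ofReal (Real.sqrt_nonneg _), smul_eq_mul,
      ← abs_of_nonneg (hgnn x), abs_mul, abs_of_nonneg (Real.sqrt_nonneg _), Real.norm_eq_abs]
  have hind : Integrable ((Set.Ioo (-1) 1).indicator (fun x : ℝ => 1 / (2 - x ^ 2))) := by
    rw [integrable_indicator_iff measurableSet_Ioo]
    have := continuousOn_one_div_two_sub_sq.integrableOn_compact isCompact_uIcc (μ := volume)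
    rw [Set.uIcc_of_le (by norm_num)] at this
    exact this.mono_set Set.Ioo_subset_Icc_self
  have hFm : Measurable F := (hgm.comp measurable_fst).indicator hmeas
  have hFi : Integrable F := by
    rw [Measure.volume_eq_prod, integrable_prod_iff hFm.aestronglyMeasurable]
    constructor
    · refine .of_forall fun x => ?_
      rw [hFsec, integrable_indicator_iff (hsec x)]
      refine integrableOn_const ?_
      rw [faceDomain_section hτ]
      exact ENNReal.ofReal_ne_top
    · simp only [hintn, hgs]
      exact hind
  refine ⟨(integrable_indicator_iff hmeas).1 hFi, ?_⟩
  rw [← integral_indicator hmeas]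
  change ∫ q, F q = _
  rw [Measure.volume_eq_prod] at hFi ⊢
  rw [integral_prod F hFi]
  simp only [hint, hgs]
  rw [integral_indicator measurableSet_Ioo, intervalIntegral.integral_of_le (by norm_num),
    integral_Ioc_eq_integral_Ioo]

theorem faceIntegrand_eqOn {σ τ : ℝ} (hσ : σ ∈ ({1, -1} : Set ℝ)) (hτ : τ ∈ ({1, -1} : Set ℝ)) :
    Set.EqOn (faceIntegrand σ τ) (fun q => 1 / ((2 - q.1 ^ 2) * √(1 - q.1 ^ 2)))
      (faceDomain τ) := fun q hq =>
  faceIntegrand_eq hσ hτ (by nlinarith [hq.1, sq_nonneg q.2])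

theorem integrableOn_faceIntegrand {σ τ : ℝ} (hσ : σ ∈ ({1, -1} : Set ℝ))
    (hτ : τ ∈ ({1, -1} : Set ℝ)) : IntegrableOn (faceIntegrand σ τ) (faceDomain τ) :=
  (integral_faceDomain hτ).1.congr_fun (faceIntegrand_eqOn hσ hτ).symm (measurableSet_faceDomain τ)

theorem integral_faceIntegrand {σ τ : ℝ} (hσ : σ ∈ ({1, -1} : Set ℝ))
    (hτ : τ ∈ ({1, -1} : Set ℝ)) :
    ∫ q in faceDomain τ, faceIntegrand σ τ q = ∫ x in (-1 : ℝ)..1, 1 / (2 - x ^ 2) := by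
  rw [setIntegral_congr_fun (measurableSet_faceDomain τ) (faceIntegrand_eqOn hσ hτ)]
  exact (integral_faceDomain hτ).2

/-- All four faces contribute the same integral. -/
theorem totalMeanCurvature_eq :
    totalMeanCurvature = 4 * ∫ x in (-1 : ℝ)..1, 1 / (2 - x ^ 2) := by
  have hne : (1 : ℝ) ∉ ({-1} : Finset ℝ) := by norm_num
  simp only [totalMeanCurvature, Finset.sum_insert hne, Finset.sum_singleton]
  rw [integral_faceIntegrand (by simp) (by simp), integral_faceIntegrand (by simp) (by simp),
    integral_faceIntegrand (by simp) (by simp), integral_faceIntegrand (by simp) (by simp)]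
  ring

theorem integral_iterated_curvature :
    (∫ x in (-1 : ℝ)..1, ∫ _y in (0 : ℝ)..√(1 - x ^ 2), 1 / ((2 - x ^ 2) * √(1 - x ^ 2))) =
      ∫ x in (-1 : ℝ)..1, 1 / (2 - x ^ 2) := by
  refine (intervalIntegrable_and_integral_of_eqOn_Ioo (by norm_num)
    continuousOn_one_div_two_sub_sq.intervalIntegrable fun x hx => ?_).2
  have h1 : 0 < 1 - x ^ 2 := by nlinarith [hx.1, hx.2]
  have h2 := Real.sqrt_pos.2 h1
  simp only [intervalIntegral.integral_const, smul_eq_mul, sub_zero]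
  field_simp

/-- The logarithmic part of the mean width, `log (√2 - 1) = -log (√2 + 1)`. -/
theorem integral_one_div_two_sub_sq :
    ∫ x in (-1 : ℝ)..1, 1 / (2 - x ^ 2) = -√2 * log (√2 - 1) := by
  have h2 : √2 ^ 2 = 2 := sq_sqrt (by norm_num)
  have h1 : 1 < √2 := by nlinarith [Real.sqrt_nonneg 2]
  have hder : ∀ x ∈ Set.uIcc (-1 : ℝ) 1,
      HasDerivAt (fun x : ℝ => √2 / 4 * (log (√2 + x) - log (√2 - x))) (1 / (2 - x ^ 2)) x := by
    intro x hx
    rw [Set.uIcc_of_le (by norm_num)] at hx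
    have hp : √2 + x ≠ 0 := by linarith [hx.1]
    have hm : √2 - x ≠ 0 := by linarith [hx.2]
    have := ((((hasDerivAt_id x).const_add √2).log hp).sub
      (((hasDerivAt_id x).const_sub √2).log hm)).const_mul (√2 / 4)
    have e : 2 - x ^ 2 = (√2 + x) * (√2 - x) := by linear_combination -h2
    refine HasDerivAt.congr_deriv this ?_
    simp only [id]
    rw [e]
    field_simp
    linear_combination (2 : ℝ) * h2
  rw [intervalIntegral.integral_eq_sub_of_hasDerivAt hder
    continuousOn_one_div_two_sub_sq.intervalIntegrable]
  have hinv : √2 + 1 = (√2 - 1)⁻¹ := eq_inv_of_mul_eq_one_left (by linear_combination h2)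
  have hl : log (√2 + 1) = -log (√2 - 1) := by rw [hinv, log_inv]
  rw [sub_neg_eq_add, ← sub_eq_add_neg, hl]
  ring

/-! ### Spherical coordinates -/

open scoped ENNReal

/-- The point of the unit sphere with longitude `θ` and polar angle `φ`. -/
noncomputable def spherePoint (θ φ : ℝ) : E3 := !₂[cos θ * sin φ, sin θ * sin φ, cos φ]

theorem continuous_spherePoint : Continuous fun p : ℝ × ℝ => spherePoint p.1 p.2 := by
  unfold spherePoint
  fun_prop

theorem norm_spherePoint (θ φ : ℝ) : ‖spherePoint θ φ‖ = 1 := by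
  rw [← sq_eq_sq₀ (norm_nonneg _) zero_le_one, ← real_inner_self_eq_norm_sq, inner_E3]
  simp [spherePoint]
  linear_combination sin φ ^ 2 * sin_sq_add_cos_sq θ + sin_sq_add_cos_sq φ

/-- Integration in polar coordinates of a function that is constant on rays from the origin. -/
theorem lintegral_ball_eq_lintegral_toSphere {f : E3 → ℝ≥0∞} (hf : Measurable f) :
    ∫⁻ x in Metric.ball (0 : E3) 1, f (‖x‖⁻¹ • x) =
      (∫⁻ v : Metric.sphere (0 : E3) 1, f v ∂(volume : Measure E3).toSphere) *
        ENNReal.ofReal (1 / 3) := by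
  set g : E3 → ℝ≥0∞ := (Metric.ball (0 : E3) 1).indicator fun x => f (‖x‖⁻¹ • x) with hg
  have h1 : ∫⁻ x in Metric.ball (0 : E3) 1, f (‖x‖⁻¹ • x) = ∫⁻ x, g x :=
    (lintegral_indicator Metric.isOpen_ball.measurableSet _).symm
  have h2 : ∫⁻ x, g x = ∫⁻ x : ({0}ᶜ : Set E3), g x ∂(volume.comap Subtype.val) := by
    rw [lintegral_subtype_comap (measurableSet_singleton _).compl, restrict_compl_singleton]
  have hmp := (volume : Measure E3).measurePreserving_homeomorphUnitSphereProd
  have h3 : ∫⁻ x : ({0}ᶜ : Set E3), g x ∂(volume.comap Subtype.val) =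
      ∫⁻ p : Metric.sphere (0 : E3) 1 × Set.Ioi (0 : ℝ),
        f p.1 * (Set.Iio (⟨1, Set.mem_Ioi.2 zero_lt_one⟩ : Set.Ioi (0 : ℝ))).indicator 1 p.2
        ∂((volume : Measure E3).toSphere.prod
          (Measure.volumeIoiPow (Module.finrank ℝ E3 - 1))) := by
    rw [← hmp.lintegral_comp_emb (Homeomorph.measurableEmbedding _)]
    refine lintegral_congr fun x => ?_
    have hx : (0 : ℝ) < ‖(x : E3)‖ := norm_pos_iff.2 x.2
    rw [hg]
    by_cases hb : ‖(x : E3)‖ < 1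
    · rw [Set.indicator_of_mem (by simpa using hb), Set.indicator_of_mem (by
        rw [Set.mem_Iio, ← Subtype.coe_lt_coe]; simpa using hb)]
      simp
    · rw [Set.indicator_of_notMem (by simpa using hb), Set.indicator_of_notMem (by
        rw [Set.mem_Iio, ← Subtype.coe_lt_coe]; simpa using hb)]
      simp
  rw [h1, h2, h3, lintegral_prod_mul (f := fun v : Metric.sphere (0 : E3) 1 => f v)
    (hf.comp measurable_subtype_coe).aemeasurable
    (measurable_one.indicator measurableSet_Iio).aemeasurable,
    lintegral_indicator_one measurableSet_Iio, Measure.volumeIoiPow_apply_Iio]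
  simp only [finrank_euclideanSpace, Fintype.card_fin]
  norm_num

theorem lintegral_E3_eq_iterated {f : E3 → ℝ≥0∞} (hf : Measurable f) :
    ∫⁻ x, f x = ∫⁻ z : ℝ, ∫⁻ w : ℝ × ℝ, f !₂[w.1, w.2, z] := by
  have h1 := (PiLp.volume_preserving_toLp (Fin 3)).lintegral_comp hf
  have h2 := (volume_preserving_piFinSuccAbove (fun _ : Fin 3 => ℝ) 2).symm.lintegral_comp
    (f := fun y => f (WithLp.toLp 2 y)) (by fun_prop)
  rw [← h1, ← h2, Measure.volume_eq_prod, lintegral_prod _ (by fun_prop)]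
  refine lintegral_congr fun z => ?_
  rw [← (volume_preserving_finTwoArrow ℝ).symm.lintegral_comp (by fun_prop)]
  refine lintegral_congr fun w => ?_
  congr 2
  funext i
  fin_cases i <;> rfl

/-- Spherical coordinates in three-space, as polar coordinates in the `(x, y)` plane followed by
polar coordinates in the half plane of the height and the distance to the axis. -/
theorem lintegral_E3_eq_spherical {f : E3 → ℝ≥0∞} (hf : Measurable f) :
    ∫⁻ x, f x = ∫⁻ θ in Set.Ioo (-π) π, ∫⁻ p in Set.Ioi (0 : ℝ) ×ˢ Set.Ioo 0 π,
      ENNReal.ofReal p.1 * (ENNReal.ofReal (p.1 * sin p.2) * f (p.1 • spherePoint θ p.2)) := by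
  have hsplit : ∀ z : ℝ, ∫⁻ w : ℝ × ℝ, f !₂[w.1, w.2, z] =
      ∫⁻ θ in Set.Ioo (-π) π, ∫⁻ ρ in Set.Ioi (0 : ℝ),
        ENNReal.ofReal ρ * f !₂[ρ * cos θ, ρ * sin θ, z] := by
    intro z
    rw [← lintegral_comp_polarCoord_symm, polarCoord_target, Measure.volume_eq_prod,
      ← Measure.prod_restrict, lintegral_prod_symm _ (by
        simp only [smul_eq_mul, polarCoord_symm_apply]; fun_prop)]
    simp only [smul_eq_mul, polarCoord_symm_apply]
  rw [lintegral_E3_eq_iterated hf]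
  simp only [hsplit]
  rw [lintegral_lintegral_swap (by
    refine Measurable.aemeasurable ?_
    have : Measurable fun p : (ℝ × ℝ) × ℝ =>
      ENNReal.ofReal p.2 * f !₂[p.2 * cos p.1.2, p.2 * sin p.1.2, p.1.1] := by fun_prop
    exact this.lintegral_prod_right')]
  refine lintegral_congr fun θ => ?_
  set k : ℝ × ℝ → ℝ≥0∞ := fun p => (Set.Ioi (0 : ℝ)).indicator
    (fun ρ => ENNReal.ofReal ρ * f !₂[ρ * cos θ, ρ * sin θ, p.1]) p.2 with hk
  have hkm : Measurable k := by
    have : k = {p : ℝ × ℝ | 0 < p.2}.indicator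
      (fun p => ENNReal.ofReal p.2 * f !₂[p.2 * cos θ, p.2 * sin θ, p.1]) := rfl
    rw [this]
    exact Measurable.indicator (by fun_prop) (measurableSet_lt measurable_const measurable_snd)
  have h1 : ∫⁻ z : ℝ, ∫⁻ ρ in Set.Ioi (0 : ℝ),
      ENNReal.ofReal ρ * f !₂[ρ * cos θ, ρ * sin θ, z] = ∫⁻ p, k p := by
    rw [Measure.volume_eq_prod, lintegral_prod _ hkm.aemeasurable]
    refine lintegral_congr fun z => ?_
    rw [← lintegral_indicator measurableSet_Ioi]
  rw [h1, ← lintegral_comp_polarCoord_symm, polarCoord_target,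
    ← lintegral_indicator (measurableSet_Ioi.prod measurableSet_Ioo),
    ← lintegral_indicator (measurableSet_Ioi.prod measurableSet_Ioo)]
  refine lintegral_congr fun ⟨r, φ⟩ => ?_
  -- on the right half of the second polar domain the distance to the axis `r sin φ` is positive
  by_cases hr : 0 < r
  swap
  · rw [Set.indicator_of_notMem (fun h => hr h.1), Set.indicator_of_notMem (fun h => hr h.1)]
  by_cases hφ : φ ∈ Set.Ioo 0 π
  · have hs := sin_pos_of_mem_Ioo hφ
    rw [Set.indicator_of_mem (show (r, φ) ∈ Set.Ioi (0 : ℝ) ×ˢ Set.Ioo (-π) π from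
      ⟨hr, by linarith [hφ.1, pi_pos], hφ.2⟩),
      Set.indicator_of_mem (show (r, φ) ∈ Set.Ioi (0 : ℝ) ×ˢ Set.Ioo 0 π from ⟨hr, hφ⟩)]
    simp only [hk, polarCoord_symm_apply, smul_eq_mul]
    rw [Set.indicator_of_mem (Set.mem_Ioi.2 (mul_pos hr hs))]
    congr 3
    ext i
    fin_cases i <;> simp [spherePoint] <;> ring
  · rw [Set.indicator_of_notMem (s := Set.Ioi (0 : ℝ) ×ˢ Set.Ioo 0 π) (fun h => hφ h.2)]
    refine Set.indicator_apply_eq_zero.2 fun h => ?_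
    have hs : sin φ ≤ 0 := by
      refine sin_nonpos_of_nonpos_of_neg_pi_le ?_ h.2.1.le
      by_contra! h0
      exact hφ ⟨h0, h.2.2⟩
    simp only [hk, polarCoord_symm_apply, smul_eq_mul]
    rw [Set.indicator_of_notMem (by
      rw [Set.mem_Ioi, not_lt]; exact mul_nonpos_of_nonneg_of_nonpos hr.le hs), mul_zero]

theorem lintegral_sq_unit_interval :
    ∫⁻ r in Set.Ioo (0 : ℝ) 1, ENNReal.ofReal (r ^ 2) = ENNReal.ofReal (1 / 3) := by
  rw [← ofReal_integral_eq_lintegral_ofReal, ← integral_Ioc_eq_integral_Ioo,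
    ← intervalIntegral.integral_of_le zero_le_one, integral_pow]
  · norm_num
  · exact (((continuous_pow 2).intervalIntegrable (0 : ℝ) 1).1).mono_set Set.Ioo_subset_Ioc_self
  · exact .of_forall fun r => sq_nonneg r

/-- The surface measure of the unit sphere is `sin φ dφ dθ`: a third of either side is the
integral over the unit ball of the extension of `f` that is constant on rays. -/
theorem lintegral_toSphere_eq {f : E3 → ℝ≥0∞} (hf : Measurable f) :
    ∫⁻ v : Metric.sphere (0 : E3) 1, f v ∂(volume : Measure E3).toSphere =
      ∫⁻ θ in Set.Ioo (-π) π, ∫⁻ φ in Set.Ioo 0 π,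
        ENNReal.ofReal (sin φ) * f (spherePoint θ φ) := by
  have hc0 : ENNReal.ofReal (1 / 3) ≠ 0 := by simp
  have hsp : ∀ θ, Measurable fun φ => f (spherePoint θ φ) := fun θ =>
    hf.comp (continuous_spherePoint.comp (by fun_prop : Continuous fun φ : ℝ => (θ, φ))).measurable
  have hgm : Measurable ((Metric.ball (0 : E3) 1).indicator fun x => f (‖x‖⁻¹ • x)) :=
    (hf.comp (by fun_prop)).indicator Metric.isOpen_ball.measurableSet
  rw [← ENNReal.mul_left_inj hc0 ENNReal.ofReal_ne_top,
    ← lintegral_ball_eq_lintegral_toSphere hf,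
    ← lintegral_indicator Metric.isOpen_ball.measurableSet, lintegral_E3_eq_spherical hgm,
    ← lintegral_mul_const' _ _ ENNReal.ofReal_ne_top]
  refine lintegral_congr fun θ => ?_
  have hpt : Set.EqOn (fun p : ℝ × ℝ => ENNReal.ofReal p.1 * (ENNReal.ofReal (p.1 * sin p.2) *
      (Metric.ball (0 : E3) 1).indicator (fun x => f (‖x‖⁻¹ • x)) (p.1 • spherePoint θ p.2)))
      (fun p => (Set.Iio 1).indicator (fun r => ENNReal.ofReal (r ^ 2)) p.1 *
        (ENNReal.ofReal (sin p.2) * f (spherePoint θ p.2)))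
      (Set.Ioi (0 : ℝ) ×ˢ Set.Ioo 0 π) := by
    rintro ⟨r, φ⟩ ⟨hr, hφ⟩
    have hr : 0 < r := hr
    have hnorm : ‖r • spherePoint θ φ‖ = r := by
      rw [norm_smul, norm_spherePoint, mul_one, Real.norm_of_nonneg hr.le]
    simp only
    by_cases h1 : r < 1
    · rw [Set.indicator_of_mem (by simpa [hnorm] using h1), Set.indicator_of_mem (by simpa using h1),
        hnorm, smul_smul, inv_mul_cancel₀ hr.ne', one_smul, ENNReal.ofReal_mul hr.le, sq,
        ENNReal.ofReal_mul hr.le]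
      ring
    · rw [Set.indicator_of_notMem (by simpa [hnorm] using h1),
        Set.indicator_of_notMem (by simpa using h1)]
      simp
  rw [setLIntegral_congr_fun (measurableSet_Ioi.prod measurableSet_Ioo) hpt,
    Measure.volume_eq_prod, ← Measure.prod_restrict,
    lintegral_prod_mul (f := (Set.Iio (1 : ℝ)).indicator fun r => ENNReal.ofReal (r ^ 2))
      (g := fun φ => ENNReal.ofReal (sin φ) * f (spherePoint θ φ))
      ((Measurable.indicator (by fun_prop) measurableSet_Iio).aemeasurable)
      (((by fun_prop : Measurable fun φ => ENNReal.ofReal (sin φ)).mul (hsp θ)).aemeasurable),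
    mul_comm, setLIntegral_indicator measurableSet_Iio, Set.Iio_inter_Ioi,
    lintegral_sq_unit_interval]

/-- The surface measure of the unit sphere is invariant under linear isometries. -/
theorem lintegral_toSphere_comp_isometry {f : E3 → ℝ≥0∞} (hf : Measurable f)
    (L : E3 ≃ₗᵢ[ℝ] E3) :
    ∫⁻ v : Metric.sphere (0 : E3) 1, f (L v) ∂(volume : Measure E3).toSphere =
      ∫⁻ v : Metric.sphere (0 : E3) 1, f v ∂(volume : Measure E3).toSphere := by
  have hc0 : ENNReal.ofReal (1 / 3) ≠ 0 := by simp
  have hgm : Measurable ((Metric.ball (0 : E3) 1).indicator fun x => f (‖x‖⁻¹ • x)) :=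
    (hf.comp (by fun_prop)).indicator Metric.isOpen_ball.measurableSet
  rw [← ENNReal.mul_left_inj hc0 ENNReal.ofReal_ne_top,
    ← lintegral_ball_eq_lintegral_toSphere hf,
    ← lintegral_ball_eq_lintegral_toSphere (f := fun v => f (L v))
      (hf.comp L.continuous.measurable),
    ← lintegral_indicator Metric.isOpen_ball.measurableSet,
    ← lintegral_indicator Metric.isOpen_ball.measurableSet,
    ← L.measurePreserving.lintegral_comp hgm]
  refine lintegral_congr fun x => ?_
  simp only [Set.indicator, Metric.mem_ball, dist_zero_right, L.norm_map, map_smul]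

theorem integral_toSphere_comp_isometry {f : E3 → ℝ} (hf : Measurable f) (h0 : ∀ v, 0 ≤ f v)
    (L : E3 ≃ₗᵢ[ℝ] E3) :
    ∫ v : Metric.sphere (0 : E3) 1, f (L v) ∂(volume : Measure E3).toSphere =
      ∫ v : Metric.sphere (0 : E3) 1, f v ∂(volume : Measure E3).toSphere := by
  rw [integral_eq_lintegral_of_nonneg_ae
      (f := fun v : Metric.sphere (0 : E3) 1 => f (L v)) (.of_forall fun v => h0 _)
      (hf.comp (L.continuous.measurable.comp measurable_subtype_coe)).aestronglyMeasurable,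
    integral_eq_lintegral_of_nonneg_ae (.of_forall fun v => h0 _)
      (hf.comp measurable_subtype_coe).aestronglyMeasurable,
    lintegral_toSphere_comp_isometry (f := fun v => ENNReal.ofReal (f v)) hf.ennreal_ofReal L]

theorem integrable_toSphere {f : E3 → ℝ} (hf : Measurable f) {C : ℝ}
    (hC : ∀ v, ‖v‖ = 1 → |f v| ≤ C) :
    Integrable (fun v : Metric.sphere (0 : E3) 1 => f v) (volume : Measure E3).toSphere :=
  .of_bound (hf.comp measurable_subtype_coe).aestronglyMeasurable C
    (.of_forall fun v => hC v (by simp))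

section Iterated

variable {f : E3 → ℝ} {C : ℝ}

theorem intervalIntegrable_sin_mul_spherePoint (hf : Measurable f)
    (hC : ∀ v, ‖v‖ = 1 → |f v| ≤ C) (θ a b : ℝ) :
    IntervalIntegrable (fun φ => sin φ * f (spherePoint θ φ)) volume a b := by
  have hm : Measurable fun φ => sin φ * f (spherePoint θ φ) := measurable_sin.mul
    (hf.comp (continuous_spherePoint.comp
      (by fun_prop : Continuous fun φ : ℝ => (θ, φ))).measurable)
  refine (intervalIntegrable_const (c := C)).mono_fun' hm.aestronglyMeasurable (.of_forall fun φ => ?_)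
  beta_reduce
  rw [norm_mul, Real.norm_eq_abs, Real.norm_eq_abs]
  have h1 := hC _ (norm_spherePoint θ φ)
  have h2 := abs_sin_le_one φ
  calc |sin φ| * |f (spherePoint θ φ)| ≤ 1 * C := by gcongr
    _ = C := one_mul C

theorem stronglyMeasurable_integral_spherePoint (hf : Measurable f) (a b : ℝ) :
    StronglyMeasurable fun θ => ∫ φ in a..b, sin φ * f (spherePoint θ φ) := by
  have hm : Measurable fun p : ℝ × ℝ => sin p.2 * f (spherePoint p.1 p.2) :=
    (measurable_sin.comp measurable_snd).mul (hf.comp continuous_spherePoint.measurable)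
  unfold intervalIntegral
  exact hm.stronglyMeasurable.integral_prod_right'.sub hm.stronglyMeasurable.integral_prod_right'

theorem intervalIntegrable_integral_spherePoint (hf : Measurable f)
    (hC : ∀ v, ‖v‖ = 1 → |f v| ≤ C) (a b c d : ℝ) :
    IntervalIntegrable (fun θ => ∫ φ in a..b, sin φ * f (spherePoint θ φ)) volume c d := by
  refine (intervalIntegrable_const (c := C * |b - a|)).mono_fun'
    (stronglyMeasurable_integral_spherePoint hf a b).aestronglyMeasurable (.of_forall fun θ => ?_)
  refine intervalIntegral.norm_integral_le_of_norm_le_const fun φ _ => ?_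
  rw [norm_mul, Real.norm_eq_abs, Real.norm_eq_abs]
  have h1 := hC _ (norm_spherePoint θ φ)
  have h2 := abs_sin_le_one φ
  calc |sin φ| * |f (spherePoint θ φ)| ≤ 1 * C := by gcongr
    _ = C := one_mul C

theorem integral_toSphere_eq (hf : Measurable f) (h0 : ∀ v, 0 ≤ f v)
    (hC : ∀ v, ‖v‖ = 1 → |f v| ≤ C) :
    ∫ v : Metric.sphere (0 : E3) 1, f v ∂(volume : Measure E3).toSphere =
      ∫ θ in (-π)..π, ∫ φ in (0 : ℝ)..π, sin φ * f (spherePoint θ φ) := by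
  have hnn : ∀ θ, ∀ φ ∈ Set.Ioc 0 π, 0 ≤ sin φ * f (spherePoint θ φ) := fun θ φ hφ =>
    mul_nonneg (sin_nonneg_of_nonneg_of_le_pi hφ.1.le hφ.2) (h0 _)
  have hin : ∀ θ, ∫⁻ φ in Set.Ioo 0 π,
      ENNReal.ofReal (sin φ) * ENNReal.ofReal (f (spherePoint θ φ)) =
        ENNReal.ofReal (∫ φ in (0 : ℝ)..π, sin φ * f (spherePoint θ φ)) := by
    intro θ
    rw [intervalIntegral.integral_of_le pi_pos.le, ofReal_integral_eq_lintegral_ofReal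
      (intervalIntegrable_sin_mul_spherePoint hf hC θ 0 π).1
      ((ae_restrict_mem measurableSet_Ioc).mono (hnn θ)),
      Measure.restrict_congr_set (Ioo_ae_eq_Ioc (μ := volume) (a := (0 : ℝ)) (b := π))]
    simp only [ENNReal.ofReal_mul' (h0 _)]
  have hpi : -π ≤ π := by linarith [pi_pos]
  have hG0 : ∀ θ, 0 ≤ ∫ φ in (0 : ℝ)..π, sin φ * f (spherePoint θ φ) := fun θ => by
    rw [intervalIntegral.integral_of_le pi_pos.le]
    exact setIntegral_nonneg measurableSet_Ioc (hnn θ)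
  rw [integral_eq_lintegral_of_nonneg_ae (.of_forall fun v => h0 _)
      (hf.comp measurable_subtype_coe).aestronglyMeasurable,
    lintegral_toSphere_eq (f := fun v => ENNReal.ofReal (f v)) hf.ennreal_ofReal]
  simp only [hin]
  rw [Measure.restrict_congr_set (Ioo_ae_eq_Ioc (μ := volume) (a := -π) (b := π)),
    ← ofReal_integral_eq_lintegral_ofReal
      (intervalIntegrable_integral_spherePoint hf hC 0 π (-π) π).1 (.of_forall hG0),
    ← intervalIntegral.integral_of_le hpi, ENNReal.toReal_ofReal]
  exact intervalIntegral.integral_nonneg hpi fun θ _ => hG0 θ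

theorem integral_zero_pi_of_symm {k : ℝ → ℝ} (hk : ∀ a b, IntervalIntegrable k volume a b)
    (hs : ∀ x, k (π - x) = k x) : ∫ x in (0 : ℝ)..π, k x = 2 * ∫ x in (0 : ℝ)..(π / 2), k x := by
  rw [← intervalIntegral.integral_add_adjacent_intervals (hk 0 (π / 2)) (hk (π / 2) π)]
  have h := intervalIntegral.integral_comp_sub_left (a := 0) (b := π / 2) k π
  rw [sub_zero, sub_half] at h
  simp only [hs] at h
  rw [← h]
  ring

/-- For a function invariant under the three coordinate reflections, integration over the sphere
is eight times integration over an octant. -/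
theorem integral_toSphere_eq_octant (hf : Measurable f) (h0 : ∀ v, 0 ≤ f v)
    (hC : ∀ v, ‖v‖ = 1 → |f v| ≤ C)
    (hx : ∀ x y z : ℝ, f !₂[-x, y, z] = f !₂[x, y, z])
    (hy : ∀ x y z : ℝ, f !₂[x, -y, z] = f !₂[x, y, z])
    (hz : ∀ x y z : ℝ, f !₂[x, y, -z] = f !₂[x, y, z]) :
    ∫ v : Metric.sphere (0 : E3) 1, f v ∂(volume : Measure E3).toSphere =
      8 * ∫ θ in (0 : ℝ)..(π / 2), ∫ φ in (0 : ℝ)..(π / 2), sin φ * f (spherePoint θ φ) := by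
  have hin : ∀ θ, ∫ φ in (0 : ℝ)..π, sin φ * f (spherePoint θ φ) =
      2 * ∫ φ in (0 : ℝ)..(π / 2), sin φ * f (spherePoint θ φ) := fun θ =>
    integral_zero_pi_of_symm (intervalIntegrable_sin_mul_spherePoint hf hC θ) fun φ => by
      simp only [spherePoint, sin_pi_sub, cos_pi_sub, hz]
  have hG := intervalIntegrable_integral_spherePoint hf hC 0 (π / 2)
  rw [integral_toSphere_eq hf h0 hC]
  simp only [hin]
  rw [intervalIntegral.integral_const_mul,
    ← intervalIntegral.integral_add_adjacent_intervals (hG (-π) 0) (hG 0 π)]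
  have hneg : ∫ θ in (-π)..0, ∫ φ in (0 : ℝ)..(π / 2), sin φ * f (spherePoint θ φ) =
      ∫ θ in (0 : ℝ)..π, ∫ φ in (0 : ℝ)..(π / 2), sin φ * f (spherePoint θ φ) := by
    have h := intervalIntegral.integral_comp_neg (a := 0) (b := π)
      (fun θ => ∫ φ in (0 : ℝ)..(π / 2), sin φ * f (spherePoint θ φ))
    rw [neg_zero] at h
    rw [← h]
    simp only [spherePoint, sin_neg, cos_neg, neg_mul, hy]
  rw [hneg, integral_zero_pi_of_symm hG fun θ => by
    simp only [spherePoint, sin_pi_sub, cos_pi_sub, neg_mul, hx]]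
  ring

end Iterated

theorem toSphere_real_univ : ((volume : Measure E3).toSphere).real Set.univ = 4 * π := by
  have h := integral_toSphere_eq_octant (f := fun _ => 1) (C := 1) measurable_const
    (fun _ => zero_le_one) (fun _ _ => by simp) (by simp) (by simp) (by simp)
  simp only [mul_one, integral_sin, intervalIntegral.integral_const, integral_const] at h
  simp only [cos_zero, cos_pi_div_two, smul_eq_mul] at h
  linarith

/-! ### The mean width as an integral over an octant -/

/-- The exchange of the coordinates `y` and `z`, which interchanges the two disks. -/
noncomputable def swapYZ : E3 ≃ₗᵢ[ℝ] E3 :=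
  LinearIsometryEquiv.piLpCongrLeft 2 ℝ ℝ (Equiv.swap 1 2)

theorem swapYZ_apply (v : E3) : swapYZ v 0 = v 0 ∧ swapYZ v 1 = v 2 ∧ swapYZ v 2 = v 1 :=
  ⟨rfl, rfl, rfl⟩

theorem two_sub_cos_sq (θ : ℝ) : 2 - cos θ ^ 2 = 1 + sin θ ^ 2 := by
  linear_combination -sin_sq_add_cos_sq θ

theorem sqrt_add_sq_le_one {v : E3} (hv : ‖v‖ = 1) :
    √(v 0 ^ 2 + v 1 ^ 2) ≤ 1 ∧ √(v 0 ^ 2 + v 2 ^ 2) ≤ 1 := by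
  have h : v 0 ^ 2 + v 1 ^ 2 + v 2 ^ 2 = 1 := by
    have := real_inner_self_eq_norm_sq v
    rw [hv, inner_E3] at this
    linarith
  constructor <;> refine Real.sqrt_le_one.2 ?_ <;> nlinarith [sq_nonneg (v 1), sq_nonneg (v 2)]

theorem measurable_max_support :
    Measurable fun v : E3 => max √(v 0 ^ 2 + v 1 ^ 2) √(v 0 ^ 2 + v 2 ^ 2) := by fun_prop

theorem max_support_le_one {v : E3} (hv : ‖v‖ = 1) :
    |max √(v 0 ^ 2 + v 1 ^ 2) √(v 0 ^ 2 + v 2 ^ 2)| ≤ 1 := by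
  rw [abs_of_nonneg (le_max_of_le_left (Real.sqrt_nonneg _))]
  exact max_le (sqrt_add_sq_le_one hv).1 (sqrt_add_sq_le_one hv).2

theorem integrable_width_body :
    Integrable (fun v : Metric.sphere (0 : E3) 1 => width Ω (v : E3))
      (volume : Measure E3).toSphere := by
  simp only [width_body]
  exact (integrable_toSphere measurable_max_support fun v hv => max_support_le_one hv).const_mul 2

theorem meanWidth_body :
    meanWidth Ω = 1 / (2 * π) * ∫ v : Metric.sphere (0 : E3) 1,
      max √((v : E3) 0 ^ 2 + (v : E3) 1 ^ 2) √((v : E3) 0 ^ 2 + (v : E3) 2 ^ 2)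
        ∂(volume : Measure E3).toSphere := by
  simp only [meanWidth, width_body]
  rw [average_eq, toSphere_real_univ, integral_const_mul, smul_eq_mul]
  field_simp
  ring

/-- The mean width as the integral of the support function over one octant of the sphere. -/
theorem meanWidth_body_eq_octant :
    meanWidth Ω = 2 * ∫ θ in (0 : ℝ)..(π / 2), ∫ φ in (0 : ℝ)..(π / 2),
      max (sin φ) (√(cos θ ^ 2 * sin φ ^ 2 + cos φ ^ 2)) * (2 / π) * sin φ := by
  have hpt : ∀ θ, ∫ φ in (0 : ℝ)..(π / 2),
      max (sin φ) (√(cos θ ^ 2 * sin φ ^ 2 + cos φ ^ 2)) * (2 / π) * sin φ =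
        2 / π * ∫ φ in (0 : ℝ)..(π / 2), sin φ * max √(spherePoint θ φ 0 ^ 2 +
          spherePoint θ φ 1 ^ 2) √(spherePoint θ φ 0 ^ 2 + spherePoint θ φ 2 ^ 2) := by
    intro θ
    rw [← intervalIntegral.integral_const_mul]
    refine intervalIntegral.integral_congr fun φ hφ => ?_
    rw [Set.uIcc_of_le (by positivity)] at hφ
    have hs : 0 ≤ sin φ := sin_nonneg_of_nonneg_of_le_pi hφ.1 (by linarith [hφ.2, pi_pos])
    have h1 : √(spherePoint θ φ 0 ^ 2 + spherePoint θ φ 1 ^ 2) = sin φ := by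
      rw [← Real.sqrt_sq hs]
      congr 1
      simp [spherePoint]
      linear_combination sin φ ^ 2 * sin_sq_add_cos_sq θ
    have h2 : spherePoint θ φ 0 ^ 2 + spherePoint θ φ 2 ^ 2 =
        cos θ ^ 2 * sin φ ^ 2 + cos φ ^ 2 := by
      simp [spherePoint]
      ring
    simp only [h1, h2]
    ring
  simp only [hpt]
  rw [meanWidth_body, integral_toSphere_eq_octant measurable_max_support
    (fun v => le_max_of_le_left (Real.sqrt_nonneg _)) (fun v hv => max_support_le_one hv)
    (by simp) (by simp) (by simp), intervalIntegral.integral_const_mul]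
  field_simp
  ring

/-- On the part of the octant with `y² > z²` the first disk supports the hull. With `θ` fixed this
part is `φ > ξ(θ)`, where `tan ξ = 1 / sin θ`; values on the boundary `y² = z²` do not matter. -/
theorem integral_spherePoint_of_eq_on_sector {f : E3 → ℝ} {θ : ℝ} (hθ : θ ∈ Set.Ioo 0 (π / 2))
    (hlo : ∀ v : E3, v 1 ^ 2 < v 2 ^ 2 → f v = 0)
    (hhi : ∀ v : E3, v 2 ^ 2 < v 1 ^ 2 → f v = √(v 0 ^ 2 + v 1 ^ 2)) :
    ∫ φ in (0 : ℝ)..(π / 2), sin φ * f (spherePoint θ φ) =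
      ∫ φ in (arccos (sin θ / √(2 - cos θ ^ 2)))..(π / 2), sin φ ^ 2 := by
  have hs : 0 < sin θ := sin_pos_of_pos_of_lt_pi hθ.1 (by linarith [hθ.2, pi_pos])
  have hd := two_sub_cos_sq θ
  rw [hd]
  have hD : 0 < 1 + sin θ ^ 2 := by positivity
  have hD' : 0 < √(1 + sin θ ^ 2) := Real.sqrt_pos.2 hD
  have hD2 : √(1 + sin θ ^ 2) ^ 2 = 1 + sin θ ^ 2 := Real.sq_sqrt hD.le
  set u := sin θ / √(1 + sin θ ^ 2) with hu
  have hu0 : 0 < u := div_pos hs hD'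
  have husq : u ^ 2 * (1 + sin θ ^ 2) = sin θ ^ 2 := by
    rw [hu, div_pow, hD2]; field_simp
  have hu1 : u ≤ 1 := by nlinarith
  have hξ0 : 0 ≤ arccos u := arccos_nonneg u
  have hξ1 : arccos u ≤ π / 2 := arccos_le_pi_div_two.2 hu0.le
  have hcosξ : cos (arccos u) = u := cos_arccos (by linarith) hu1
  have hsq : ∀ φ, spherePoint θ φ 1 ^ 2 = sin θ ^ 2 * (1 - cos φ ^ 2) ∧
      spherePoint θ φ 2 ^ 2 = cos φ ^ 2 := fun φ => by
    constructor
    · simp [spherePoint]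
      linear_combination sin θ ^ 2 * sin_sq_add_cos_sq φ
    · simp [spherePoint]
  -- `φ < ξ` is equivalent to `cos² φ > sin² θ sin² φ`, that is `z² > y²`
  have hA := intervalIntegrable_and_integral_of_eqOn_Ioo (g := fun _ => (0 : ℝ))
    (f := fun φ => sin φ * f (spherePoint θ φ)) hξ0 intervalIntegrable_const (by
      intro φ hφ
      have hc : u < cos φ := by
        rw [← hcosξ]
        exact cos_lt_cos_of_nonneg_of_le_pi hφ.1.le (by linarith [pi_pos]) hφ.2
      have : f (spherePoint θ φ) = 0 := hlo _ (by
        rw [(hsq φ).1, (hsq φ).2]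
        nlinarith [mul_lt_mul_of_pos_right (pow_lt_pow_left₀ hc hu0.le two_ne_zero) hD])
      simp only [this, mul_zero])
  have hB := intervalIntegrable_and_integral_of_eqOn_Ioo (g := fun φ => sin φ ^ 2)
    (f := fun φ => sin φ * f (spherePoint θ φ)) hξ1
    ((continuous_sin.pow 2).intervalIntegrable _ _) (by
      intro φ hφ
      have hc : cos φ < u := by
        rw [← hcosξ]
        exact cos_lt_cos_of_nonneg_of_le_pi hξ0 (by linarith [pi_pos, hφ.2]) hφ.1
      have hφ0 : 0 < φ := lt_of_le_of_lt hξ0 hφ.1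
      have hc0 : 0 < cos φ := cos_pos_of_mem_Ioo ⟨by linarith [pi_pos], hφ.2⟩
      have hsφ : 0 ≤ sin φ := sin_nonneg_of_nonneg_of_le_pi hφ0.le (by linarith [hφ.2, pi_pos])
      have hfv := hhi (spherePoint θ φ) (by
        rw [(hsq φ).1, (hsq φ).2]
        nlinarith [mul_lt_mul_of_pos_right (pow_lt_pow_left₀ hc hc0.le two_ne_zero) hD])
      have h1 : √(spherePoint θ φ 0 ^ 2 + spherePoint θ φ 1 ^ 2) = sin φ := by
        rw [← Real.sqrt_sq hsφ]
        congr 1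
        simp [spherePoint]
        linear_combination sin φ ^ 2 * sin_sq_add_cos_sq θ
      simp only [hfv, h1]
      ring)
  rw [← intervalIntegral.integral_add_adjacent_intervals hA.1 hB.1, hA.2, hB.2,
    intervalIntegral.integral_zero, zero_add]

theorem integral_toSphere_of_eq_on_sector {f : E3 → ℝ} (hf : Measurable f) (h0 : ∀ v, 0 ≤ f v)
    (hC : ∀ v, ‖v‖ = 1 → |f v| ≤ 1)
    (hx : ∀ x y z : ℝ, f !₂[-x, y, z] = f !₂[x, y, z])
    (hy : ∀ x y z : ℝ, f !₂[x, -y, z] = f !₂[x, y, z])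
    (hz : ∀ x y z : ℝ, f !₂[x, y, -z] = f !₂[x, y, z])
    (hlo : ∀ v : E3, v 1 ^ 2 < v 2 ^ 2 → f v = 0)
    (hhi : ∀ v : E3, v 2 ^ 2 < v 1 ^ 2 → f v = √(v 0 ^ 2 + v 1 ^ 2)) :
    ∫ v : Metric.sphere (0 : E3) 1, f v ∂(volume : Measure E3).toSphere =
      8 * ∫ θ in (0 : ℝ)..(π / 2),
        ∫ φ in (arccos (sin θ / √(2 - cos θ ^ 2)))..(π / 2), sin φ ^ 2 := by
  rw [integral_toSphere_eq_octant hf h0 hC hx hy hz]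
  congr 1
  exact intervalIntegral.integral_congr_Ioo_of_le (by positivity) fun θ hθ =>
    integral_spherePoint_of_eq_on_sector hθ hlo hhi

/-- The exchange of `y` and `z` shows that the two regions `y² ≥ z²` and `y² < z²` of the sphere
contribute equally. -/
theorem meanWidth_body_eq_sector :
    meanWidth Ω = 8 / π * ∫ θ in (0 : ℝ)..(π / 2),
      ∫ φ in (arccos (sin θ / √(2 - cos θ ^ 2)))..(π / 2), sin φ ^ 2 := by
  set p : E3 → ℝ := fun v => √(v 0 ^ 2 + v 1 ^ 2) with hp
  set A : E3 → ℝ := {v : E3 | v 2 ^ 2 ≤ v 1 ^ 2}.indicator p with hA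
  set B : E3 → ℝ := {v : E3 | v 2 ^ 2 < v 1 ^ 2}.indicator p with hB
  have hpm : Measurable p := by rw [hp]; fun_prop
  have hp0 : ∀ v, 0 ≤ p v := fun v => Real.sqrt_nonneg _
  have hsA : MeasurableSet {v : E3 | v 2 ^ 2 ≤ v 1 ^ 2} :=
    measurableSet_le (by fun_prop) (by fun_prop)
  have hsB : MeasurableSet {v : E3 | v 2 ^ 2 < v 1 ^ 2} :=
    measurableSet_lt (by fun_prop) (by fun_prop)
  have hAm : Measurable A := hpm.indicator hsA
  have hBm : Measurable B := hpm.indicator hsB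
  have hA0 : ∀ v, 0 ≤ A v := fun v => Set.indicator_nonneg (fun v _ => hp0 v) v
  have hB0 : ∀ v, 0 ≤ B v := fun v => Set.indicator_nonneg (fun v _ => hp0 v) v
  have hA1 : ∀ v, ‖v‖ = 1 → |A v| ≤ 1 := fun v hv => by
    rw [abs_of_nonneg (hA0 v)]
    exact (Set.indicator_le_self' (fun v _ => hp0 v) v).trans (sqrt_add_sq_le_one hv).1
  have hB1 : ∀ v, ‖v‖ = 1 → |B v| ≤ 1 := fun v hv => by
    rw [abs_of_nonneg (hB0 v)]
    exact (Set.indicator_le_self' (fun v _ => hp0 v) v).trans (sqrt_add_sq_le_one hv).1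
  -- the boundary `y² = z²` is counted in `A` only
  have hsplit : ∀ v : E3, max √(v 0 ^ 2 + v 1 ^ 2) √(v 0 ^ 2 + v 2 ^ 2) = A v + B (swapYZ v) := by
    intro v
    obtain ⟨e0, e1, e2⟩ := swapYZ_apply v
    simp only [hA, hB, hp, Set.indicator, Set.mem_ofPred_eq, e0, e1, e2]
    rcases le_or_gt (v 2 ^ 2) (v 1 ^ 2) with h | h
    · rw [if_pos h, if_neg (not_lt.2 h), add_zero, max_eq_left (Real.sqrt_le_sqrt (by linarith))]
    · rw [if_neg (not_le.2 h), if_pos h, zero_add, max_eq_right (Real.sqrt_le_sqrt (by linarith))]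
  have hBs : ∀ v, ‖v‖ = 1 → |B (swapYZ v)| ≤ 1 := fun v hv =>
    hB1 _ (by rw [LinearIsometryEquiv.norm_map, hv])
  rw [meanWidth_body]
  simp only [hsplit]
  rw [integral_add (integrable_toSphere hAm hA1) (integrable_toSphere
      (f := fun v => B (swapYZ v)) (hBm.comp swapYZ.continuous.measurable) hBs),
    integral_toSphere_comp_isometry hBm hB0 swapYZ,
    integral_toSphere_of_eq_on_sector hAm hA0 hA1 (by
        intros; simp [hA, hp, Set.indicator]; congr)
      (by
        intros; simp [hA, hp, Set.indicator]; congr) (by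
        intros; simp [hA, hp, Set.indicator]; congr)
      (fun v hv => Set.indicator_of_notMem (s := {v : E3 | v 2 ^ 2 ≤ v 1 ^ 2}) (not_le.2 hv) _)
      (fun v hv => Set.indicator_of_mem (show v ∈ {v : E3 | v 2 ^ 2 ≤ v 1 ^ 2} from hv.le) _),
    integral_toSphere_of_eq_on_sector hBm hB0 hB1 (by
        intros; simp [hB, hp, Set.indicator]; congr)
      (by
        intros; simp [hB, hp, Set.indicator]; congr) (by
        intros; simp [hB, hp, Set.indicator]; congr)
      (fun v hv => Set.indicator_of_notMem (s := {v : E3 | v 2 ^ 2 < v 1 ^ 2}) (not_lt.2 hv.le) _)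
      (fun v hv => Set.indicator_of_mem (show v ∈ {v : E3 | v 2 ^ 2 < v 1 ^ 2} from hv) _)]
  field_simp
  ring

/-! ### Reduction to one-dimensional integrals -/

theorem integral_sin_sq_sector (θ : ℝ) :
    ∫ φ in (arccos (sin θ / √(2 - cos θ ^ 2)))..(π / 2), sin φ ^ 2 =
      (arctan (sin θ) + sin θ / (1 + sin θ ^ 2)) / 2 := by
  have hd := two_sub_cos_sq θ
  rw [hd, integral_sin_sq, arctan_eq_arcsin]
  have hD : 0 < 1 + sin θ ^ 2 := by positivity
  have hD' : 0 < √(1 + sin θ ^ 2) := Real.sqrt_pos.2 hD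
  have hD2 : √(1 + sin θ ^ 2) ^ 2 = 1 + sin θ ^ 2 := Real.sq_sqrt hD.le
  have habs : |sin θ / √(1 + sin θ ^ 2)| ≤ 1 := by
    rw [← sq_le_one_iff_abs_le_one, div_pow, hD2, div_le_one hD]
    linarith
  have hsin : √(1 - (sin θ / √(1 + sin θ ^ 2)) ^ 2) = 1 / √(1 + sin θ ^ 2) := by
    rw [div_pow, hD2, ← Real.sqrt_one, ← Real.sqrt_div zero_le_one, Real.sqrt_one]
    congr 1
    field_simp
    ring
  rw [cos_pi_div_two, mul_zero, sin_arccos, cos_arccos (abs_le.1 habs).1 (abs_le.1 habs).2, hsin,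
    arccos]
  have : 1 / √(1 + sin θ ^ 2) * (sin θ / √(1 + sin θ ^ 2)) = sin θ / (1 + sin θ ^ 2) := by
    rw [div_mul_div_comm, one_mul, ← sq, hD2]
  rw [this]
  ring

theorem continuous_sin_div : Continuous fun θ : ℝ => sin θ / (1 + sin θ ^ 2) :=
  continuous_sin.div (by fun_prop) fun θ => by positivity

/-- The substitution `x = cos θ`. -/
theorem integral_sin_div :
    ∫ θ in (0 : ℝ)..π, sin θ / (1 + sin θ ^ 2) = ∫ x in (-1 : ℝ)..1, 1 / (2 - x ^ 2) := by
  have h := intervalIntegral.integral_comp_mul_deriv' (a := 0) (b := π) (f := cos)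
    (f' := fun θ => -sin θ) (g := fun x => 1 / (2 - x ^ 2)) (fun θ _ => hasDerivAt_cos θ)
    (by fun_prop) (continuousOn_one_div_two_sub_sq.mono (by
      rintro _ ⟨θ, _, rfl⟩
      rw [Set.uIcc_of_le (by norm_num)]
      exact ⟨neg_one_le_cos θ, cos_le_one θ⟩))
  rw [cos_zero, cos_pi, intervalIntegral.integral_symm (-1) 1] at h
  rw [← neg_inj, ← h, ← intervalIntegral.integral_neg]
  refine intervalIntegral.integral_congr fun θ _ => ?_
  have hd := two_sub_cos_sq θ
  simp only [Function.comp_apply, hd]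
  ring

theorem integral_arctan_sin_zero_pi :
    ∫ θ in (0 : ℝ)..π, arctan (sin θ) = 2 * ∫ θ in (0 : ℝ)..(π / 2), arctan (sin θ) :=
  integral_zero_pi_of_symm
    (fun a b => (continuous_arctan.comp continuous_sin).intervalIntegrable a b)
    fun θ => by rw [sin_pi_sub]

theorem meanWidth_body_eq_arctan :
    meanWidth Ω = 2 / π * ((∫ θ in (0 : ℝ)..π, arctan (sin θ)) +
      ∫ x in (-1 : ℝ)..1, 1 / (2 - x ^ 2)) := by
  rw [meanWidth_body_eq_sector]
  simp only [integral_sin_sq_sector]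
  have hc : Continuous fun θ : ℝ => arctan (sin θ) := continuous_arctan.comp continuous_sin
  rw [intervalIntegral.integral_div, intervalIntegral.integral_add (hc.intervalIntegrable _ _)
    (continuous_sin_div.intervalIntegrable _ _), integral_arctan_sin_zero_pi, ← integral_sin_div,
    integral_zero_pi_of_symm (fun a b => continuous_sin_div.intervalIntegrable a b)
      fun θ => by rw [sin_pi_sub]]
  ring

theorem integral_arccos_dihedral :
    ∫ θ in (0 : ℝ)..π, arccos (1 / √(2 - cos θ ^ 2)) = ∫ θ in (0 : ℝ)..π, arctan (sin θ) := by
  refine intervalIntegral.integral_congr fun θ hθ => ?_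
  rw [Set.uIcc_of_le pi_pos.le] at hθ
  have hd := two_sub_cos_sq θ
  simp only [hd, arctan_eq_arccos (sin_nonneg_of_nonneg_of_le_pi hθ.1 hθ.2), one_div]

/-! ### The dilogarithm -/

/-- The imaginary part of `-log (1 - q e^{iθ})`. -/
theorem hasSum_pow_mul_sin {q : ℝ} (hq0 : 0 ≤ q) (hq1 : q < 1) (θ : ℝ) :
    HasSum (fun n : ℕ => q ^ (n + 1) * sin ((n + 1) * θ) / (n + 1))
      (arctan (q * sin θ / (1 - q * cos θ))) := by
  set z : ℂ := q * Complex.exp (θ * Complex.I) with hz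
  have hnorm : ‖z‖ < 1 := by
    rw [hz, norm_mul, Complex.norm_exp_ofReal_mul_I, mul_one, Complex.norm_real,
      Real.norm_of_nonneg hq0]
    exact hq1
  have hre : (1 - z).re = 1 - q * cos θ := by
    simp [hz, Complex.exp_ofReal_mul_I_re]
  have him : (1 - z).im = -(q * sin θ) := by
    simp [hz, Complex.exp_ofReal_mul_I_im]
  have hpos : 0 < 1 - q * cos θ := by nlinarith [cos_le_one θ, neg_one_le_cos θ]
  have h := Complex.imCLM.hasSum (Complex.hasSum_taylorSeries_neg_log' hnorm)
  have harg := abs_lt.1 (Complex.abs_arg_lt_pi_div_two_iff.2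
    (Or.inl (by rw [hre]; exact hpos) : 0 < (1 - z).re ∨ 1 - z = 0))
  have hlim : Complex.imCLM (-Complex.log (1 - z)) = arctan (q * sin θ / (1 - q * cos θ)) := by
    rw [Complex.imCLM_apply, Complex.neg_im, Complex.log_im, ← arctan_tan harg.1 harg.2,
      Complex.tan_arg, hre, him, ← arctan_neg, neg_div, neg_neg]
  rw [hlim] at h
  convert h using 2 with n
  have hpow : z ^ (n + 1) / (n + 1) =
      ((q ^ (n + 1) / (n + 1) : ℝ) : ℂ) * Complex.exp (((n + 1) * θ : ℝ) * Complex.I) := by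
    rw [hz, mul_pow, ← Complex.exp_nat_mul]
    push_cast
    rw [mul_div_right_comm]
    congr 2
    ring
  rw [hpow, Complex.imCLM_apply, Complex.im_ofReal_mul,
    Complex.exp_ofReal_mul_I_im]
  ring

/-- The two halves of the sine series at `θ` and `π - θ` combine by the addition theorem of the
arctangent; `q = √2 - 1` is the positive solution of `2 q / (1 - q ^ 2) = 1`. -/
theorem arctan_add_arctan_eq_arctan_sin {q : ℝ} (hq : q ^ 2 + 2 * q = 1) (hq0 : 0 < q) (θ : ℝ) :
    arctan (q * sin θ / (1 - q * cos θ)) +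
      arctan (q * sin (π - θ) / (1 - q * cos (π - θ))) = arctan (sin θ) := by
  have hq1 : q < 1 := by nlinarith
  have hm : 0 < 1 - q * cos θ := by nlinarith [cos_le_one θ, neg_one_le_cos θ]
  have hp : 0 < 1 + q * cos θ := by nlinarith [cos_le_one θ, neg_one_le_cos θ]
  rw [sin_pi_sub, cos_pi_sub, mul_neg, sub_neg_eq_add]
  have hsc := sin_sq_add_cos_sq θ
  have hden : 1 - q * sin θ / (1 - q * cos θ) * (q * sin θ / (1 + q * cos θ)) =
      2 * q / ((1 - q * cos θ) * (1 + q * cos θ)) := by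
    field_simp
    linear_combination -q ^ 2 * hsc - hq
  have hlt : q * sin θ / (1 - q * cos θ) * (q * sin θ / (1 + q * cos θ)) < 1 := by
    have : 0 < 2 * q / ((1 - q * cos θ) * (1 + q * cos θ)) := by positivity
    linarith
  rw [arctan_add hlt, hden]
  congr 1
  field_simp
  ring

theorem summable_dilog {x : ℝ} (hx : |x| < 1) :
    Summable fun k : ℕ => x ^ (k + 1) / ((k : ℝ) + 1) ^ 2 := by
  refine .of_norm_bounded (g := fun k : ℕ => |x| ^ k)
    (summable_geometric_of_lt_one (abs_nonneg x) hx) fun k => ?_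
  have hk : (1 : ℝ) ≤ ((k : ℝ) + 1) ^ 2 := one_le_pow₀ (by linarith [Nat.cast_nonneg (α := ℝ) k])
  rw [norm_div, norm_pow, Real.norm_eq_abs, Real.norm_of_nonneg (by positivity)]
  calc |x| ^ (k + 1) / ((k : ℝ) + 1) ^ 2 ≤ |x| ^ (k + 1) := div_le_self (by positivity) hk
    _ ≤ |x| ^ k := pow_le_pow_of_le_one (abs_nonneg x) hx.le k.le_succ

theorem hasSum_dilog_sub_dilog_neg {q : ℝ} (hq : |q| < 1) :
    HasSum (fun k : ℕ => (q ^ (k + 1) - (-q) ^ (k + 1)) / ((k : ℝ) + 1) ^ 2)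
      (dilog q - dilog (-q)) := by
  simp only [sub_div]
  exact (summable_dilog hq).hasSum.sub (summable_dilog (by rwa [abs_neg])).hasSum

/-- Termwise integration of the sine series over `[0, π]`. -/
theorem integral_arctan_eq_dilog {q : ℝ} (hq0 : 0 < q) (hq1 : q < 1) :
    ∫ θ in (0 : ℝ)..π, arctan (q * sin θ / (1 - q * cos θ)) = dilog q - dilog (-q) := by
  have h := intervalIntegral.hasSum_integral_of_dominated_convergence (μ := volume)
    (a := 0) (b := π) (F := fun (n : ℕ) θ => q ^ (n + 1) * sin ((n + 1) * θ) / (n + 1))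
    (fun n _ => q ^ n) (fun n => by fun_prop)
    (fun n => .of_forall fun θ _ => by
      have hn : (1 : ℝ) ≤ n + 1 := by linarith [Nat.cast_nonneg (α := ℝ) n]
      rw [norm_div, norm_mul, norm_pow, Real.norm_of_nonneg hq0.le,
        Real.norm_of_nonneg (by positivity : (0 : ℝ) ≤ n + 1), Real.norm_eq_abs]
      have hs := abs_sin_le_one ((n + 1) * θ)
      calc q ^ (n + 1) * |sin ((n + 1) * θ)| / (n + 1) ≤ q ^ (n + 1) * |sin ((n + 1) * θ)| :=
            div_le_self (by positivity) hn
        _ ≤ q ^ (n + 1) * 1 := by gcongr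
        _ ≤ q ^ n := by rw [mul_one]; exact pow_le_pow_of_le_one hq0.le hq1.le n.le_succ)
    (.of_forall fun _ _ => summable_geometric_of_lt_one hq0.le hq1) intervalIntegrable_const
    (.of_forall fun θ _ => hasSum_pow_mul_sin hq0.le hq1 θ)
  refine h.unique ((hasSum_dilog_sub_dilog_neg (abs_lt.2 ⟨by linarith, hq1⟩)).congr_fun fun n => ?_)
  have hn : (n : ℝ) + 1 ≠ 0 := by positivity
  have hc : cos (((n : ℝ) + 1) * π) = (-1) ^ (n + 1) := by
    have := cos_nat_mul_pi (n + 1)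
    push_cast at this
    exact this
  rw [intervalIntegral.integral_div, intervalIntegral.integral_const_mul,
    intervalIntegral.integral_comp_mul_left (fun x => sin x) hn, integral_sin, mul_zero, cos_zero,
    neg_pow q, smul_eq_mul, hc]
  field_simp

theorem sqrt_two_sub_one_bounds :
    0 < √2 - 1 ∧ √2 - 1 < 1 ∧ (√2 - 1) ^ 2 + 2 * (√2 - 1) = 1 := by
  have h2 : √2 ^ 2 = 2 := Real.sq_sqrt (by norm_num)
  have h0 := Real.sqrt_nonneg 2
  refine ⟨by nlinarith, by nlinarith, by linear_combination h2⟩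

theorem continuous_arctan_sin_div {q : ℝ} (hq0 : 0 < q) (hq1 : q < 1) :
    Continuous fun θ : ℝ => arctan (q * sin θ / (1 - q * cos θ)) := by
  refine continuous_arctan.comp (Continuous.div (by fun_prop) (by fun_prop) fun θ => ?_)
  nlinarith [cos_le_one θ, neg_one_le_cos θ]

theorem integral_arctan_sin :
    ∫ θ in (0 : ℝ)..π, arctan (sin θ) = 2 * (dilog (√2 - 1) - dilog (1 - √2)) := by
  obtain ⟨hq0, hq1, hq⟩ := sqrt_two_sub_one_bounds
  have hc := continuous_arctan_sin_div hq0 hq1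
  have h := intervalIntegral.integral_comp_sub_left (a := 0) (b := π)
    (fun θ => arctan ((√2 - 1) * sin θ / (1 - (√2 - 1) * cos θ))) π
  rw [sub_self, sub_zero] at h
  have hc' : Continuous fun θ : ℝ =>
      arctan ((√2 - 1) * sin (π - θ) / (1 - (√2 - 1) * cos (π - θ))) :=
    hc.comp (continuous_const.sub continuous_id)
  simp only [← arctan_add_arctan_eq_arctan_sin hq hq0]
  rw [intervalIntegral.integral_add (hc.intervalIntegrable _ _) (hc'.intervalIntegrable _ _), h,
    integral_arctan_eq_dilog hq0 hq1, neg_sub]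
  ring

theorem meanWidth_body_closed_form :
    meanWidth Ω =
      -(1 / π) * (2 * √2 * log (√2 - 1) - 4 * dilog (√2 - 1) + 4 * dilog (1 - √2)) := by
  rw [meanWidth_body_eq_arctan, integral_arctan_sin, integral_one_div_two_sub_sq]
  ring

/-! ### Numerical bounds -/

theorem abs_arctan_partial_sum_sub_le {x : ℝ} (hx0 : 0 ≤ x) (hx1 : x < 1) (N : ℕ) :
    |∑ n ∈ Finset.range N, (-1) ^ n * x ^ (2 * n + 1) / ((2 * n + 1 : ℕ) : ℝ) - arctan x| ≤
      x * (x ^ 2) ^ N / (1 - x ^ 2) := by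
  have hx2 : x ^ 2 < 1 := by nlinarith
  refine norm_sub_le_of_geometric_bound_of_hasSum hx2 (fun n => ?_)
    (Real.hasSum_arctan (by rwa [Real.norm_of_nonneg hx0])) N
  have hn : (1 : ℝ) ≤ ((2 * n + 1 : ℕ) : ℝ) := by
    push_cast; linarith [Nat.cast_nonneg (α := ℝ) n]
  rw [norm_div, norm_mul, norm_pow, norm_neg, norm_one, one_pow, one_mul, norm_pow,
    Real.norm_of_nonneg hx0, Real.norm_of_nonneg (zero_le_one.trans hn), ← pow_mul, ← pow_succ']
  exact div_le_self (by positivity) hn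

/-- Bounds on `π` at the 29th decimal, from Machin's formula and the arctangent series. -/
theorem pi_bounds : 3.14159265358979323846264338327 < π ∧ π < 3.14159265358979323846264338328 := by
  have h := four_mul_arctan_inv_5_sub_arctan_inv_239
  have h5 := abs_le.1 (abs_arctan_partial_sum_sub_le (x := 5⁻¹) (by norm_num) (by norm_num) 25)
  have h239 := abs_le.1 (abs_arctan_partial_sum_sub_le (x := 239⁻¹) (by norm_num) (by norm_num) 8)
  norm_num [Finset.sum_range_succ] at h5 h239
  constructor <;> linarith [h5.1, h5.2, h239.1, h239.2]

/-- Since `(1 + q) / (1 - q) = 1 / q` for `q = √2 - 1`, the logarithm and the dilogarithms in the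
closed form are series in the odd powers of the same number. -/
theorem hasSum_pi_mul_meanWidth_body :
    HasSum (fun n : ℕ => (√2 - 1) ^ (2 * n + 1) *
      (4 * (√2 - 1 + 1) / (2 * n + 1) + 8 / (2 * n + 1) ^ 2)) (π * meanWidth Ω) := by
  obtain ⟨hq0, hq1, hq⟩ := sqrt_two_sub_one_bounds
  have habs : |√2 - 1| < 1 := abs_lt.2 ⟨by linarith, hq1⟩
  have hval : π * meanWidth Ω = -(2 * √2 * log (√2 - 1)) +
      4 * (dilog (√2 - 1) - dilog (-(√2 - 1))) := by
    rw [meanWidth_body_closed_form, neg_sub]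
    field_simp
    ring
  have hlog := hasSum_log_sub_log_of_abs_lt_one habs
  have hdil : HasSum (fun n : ℕ => 2 * (√2 - 1) ^ (2 * n + 1) / (2 * (n : ℝ) + 1) ^ 2)
      (dilog (√2 - 1) - dilog (-(√2 - 1))) := by
    have hinj : Function.Injective fun n : ℕ => 2 * n := fun a b h => by
      simpa using h
    -- only the odd powers of `q`, the terms with even index `k`, survive in the difference
    refine ((hinj.hasSum_iff fun k hk => ?_).2 (hasSum_dilog_sub_dilog_neg habs)).congr_fun
      fun n => ?_
    · have hk' : Even (k + 1) := by
        by_contra hodd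
        rw [Nat.even_add_one, not_not] at hodd
        obtain ⟨m, rfl⟩ := hodd
        exact hk ⟨m, by ring⟩
      rw [hk'.neg_pow, sub_self, zero_div]
    · have ho : Odd (2 * n + 1) := ⟨n, rfl⟩
      simp only [Function.comp_apply, ho.neg_pow]
      push_cast
      ring
  set q := √2 - 1 with hqdef
  have h2 : √2 = q + 1 := by rw [hqdef]; ring
  have hL : log (1 + q) - log (1 - q) = -log q := by
    rw [← log_div (by linarith) (by linarith), ← log_inv]
    congr 1
    rw [div_eq_iff (by linarith), eq_comm, inv_mul_eq_iff_eq_mul₀ hq0.ne']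
    linarith
  rw [hL] at hlog
  rw [hval, h2]
  convert! (hlog.mul_left (2 * (q + 1))).add (hdil.mul_left 4) using 1
  · funext n
    have : (2 * (n : ℝ) + 1) ≠ 0 := by positivity
    field_simp
    ring
  · ring

/-- The tail after 38 terms, bounded by a geometric series with ratio `0.172 > (√2 - 1) ^ 2`. -/
theorem abs_series_partial_sum_sub_le :
    |∑ n ∈ Finset.range 38, (√2 - 1) ^ (2 * n + 1) *
      (4 * (√2 - 1 + 1) / (2 * n + 1) + 8 / (2 * n + 1) ^ 2) - π * meanWidth Ω| ≤
        14 * 0.172 ^ 38 / (1 - 0.172) := by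
  obtain ⟨hq0, hq1, hq⟩ := sqrt_two_sub_one_bounds
  refine norm_sub_le_of_geometric_bound_of_hasSum (by norm_num) (fun n => ?_)
    hasSum_pi_mul_meanWidth_body 38
  set q := √2 - 1
  have hn : (1 : ℝ) ≤ 2 * n + 1 := by linarith [Nat.cast_nonneg (α := ℝ) n]
  have hn2 : (1 : ℝ) ≤ (2 * n + 1) ^ 2 := one_le_pow₀ hn
  have hqs : q ^ 2 ≤ 0.172 := by nlinarith
  have h1 : 4 * (q + 1) / (2 * n + 1) ≤ 4 * (q + 1) := div_le_self (by positivity) hn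
  have h2 : 8 / (2 * (n : ℝ) + 1) ^ 2 ≤ 8 := div_le_self (by positivity) hn2
  have h3 : q * (4 * (q + 1) / (2 * n + 1) + 8 / (2 * n + 1) ^ 2) ≤ 14 := by nlinarith
  rw [Real.norm_of_nonneg (by positivity), pow_succ, pow_mul, mul_assoc, mul_comm]
  gcongr

theorem sqrt_two_sub_one_digits :
    0.41421356237309504880168872420969 ≤ √2 - 1 ∧ √2 - 1 ≤ 0.41421356237309504880168872420970 := by
  constructor
  · rw [le_sub_iff_add_le]
    exact Real.le_sqrt_of_sq_le (by norm_num)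
  · rw [sub_le_iff_le_add, Real.sqrt_le_left (by norm_num)]
    norm_num

theorem partial_sum_lower :
    (5.874064361314209399992176400 : ℝ) ≤ ∑ n ∈ Finset.range 38, (√2 - 1) ^ (2 * n + 1) *
      (4 * (√2 - 1 + 1) / (2 * n + 1) + 8 / (2 * n + 1) ^ 2) := by
  refine le_trans ?_ (Finset.sum_le_sum (f := fun n : ℕ =>
    (0.41421356237309504880168872420969 : ℝ) ^ (2 * n + 1) *
      (4 * (0.41421356237309504880168872420969 + 1) / (2 * n + 1) + 8 / (2 * n + 1) ^ 2))
    fun n _ => ?_)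
  · norm_num [Finset.sum_range_succ]
  · have := sqrt_two_sub_one_digits.1
    gcongr

theorem partial_sum_upper :
    ∑ n ∈ Finset.range 38, (√2 - 1) ^ (2 * n + 1) *
      (4 * (√2 - 1 + 1) / (2 * n + 1) + 8 / (2 * n + 1) ^ 2) ≤ (5.874064361314209399992176401 : ℝ) := by
  refine le_trans (Finset.sum_le_sum (g := fun n : ℕ =>
    (0.41421356237309504880168872420970 : ℝ) ^ (2 * n + 1) *
      (4 * (0.41421356237309504880168872420970 + 1) / (2 * n + 1) + 8 / (2 * n + 1) ^ 2))
    fun n _ => ?_) ?_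
  · have h0 := sqrt_two_sub_one_bounds.1
    have := sqrt_two_sub_one_digits.2
    gcongr
  · norm_num [Finset.sum_range_succ]

theorem meanWidth_body_digits :
    1.8697727582861870379136441 ≤ meanWidth Ω ∧ meanWidth Ω < 1.8697727582861870379136442 := by
  have h := abs_le.1 abs_series_partial_sum_sub_le
  have hl := partial_sum_lower
  have hu := partial_sum_upper
  have hp := pi_bounds
  have herr : (14 : ℝ) * 0.172 ^ 38 / (1 - 0.172) ≤ 0.000000000000000000000000001 := by norm_num
  constructor
  · by_contra! hlt
    have := mul_lt_mul_of_pos_left hlt pi_pos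
    linarith [h.2, hp.2]
  · by_contra! hlt
    have := mul_le_mul_of_nonneg_left hlt pi_pos.le
    linarith [h.1, hp.1]

/-! ### The curvature formula and the theorem -/

theorem meanWidth_body_eq_curvature :
    meanWidth Ω = 1 / (2 * π) * totalMeanCurvature + 1 / (4 * π) * totalDihedral := by
  rw [totalMeanCurvature_eq, totalDihedral_eq, integral_arccos_dihedral, meanWidth_body_eq_arctan]
  field_simp
  ring

theorem mainTheorem1 :
    -- the width is integrable over the sphere, and the mean width has the closed form
    (Integrable (fun v : Metric.sphere (0 : E3) 1 => width Ω (v : E3))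
        (volume : Measure E3).toSphere ∧
      meanWidth Ω = -(1 / π) * (2 * √2 * log (√2 - 1) - 4 * dilog (√2 - 1) + 4 * dilog (1 - √2))) ∧
    -- its decimal expansion
    (1.8697727582861870379136441 ≤ meanWidth Ω ∧ meanWidth Ω < 1.8697727582861870379136442) ∧
    -- the boundary of the body
    (frontier Ω = {p : E3 | p 0 ^ 2 + p 1 ^ 2 ≤ 1 ∧
        (p 2 = √(1 - p 0 ^ 2) - |p 1| ∨ p 2 = -(√(1 - p 0 ^ 2) - |p 1|))} ∧
      ∀ σ ∈ ({1, -1} : Set ℝ), ∀ τ ∈ ({1, -1} : Set ℝ), ∀ x y : ℝ,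
        x ^ 2 < 1 → x ^ 2 + y ^ 2 ≤ 1 → 0 ≤ τ * y →
          ‖faceNormal σ τ x y‖ = 1 ∧
          ∀ q ∈ Ω, inner ℝ (faceNormal σ τ x y) (q - !₂[x, y, faceFun σ τ x y]) ≤ 0) ∧
    -- the curvature and dihedral angle formula
    ((∀ σ ∈ ({1, -1} : Set ℝ), ∀ τ ∈ ({1, -1} : Set ℝ),
        IntegrableOn (faceIntegrand σ τ) (faceDomain τ)) ∧
      (∀ τ ∈ ({1, -1} : Set ℝ),
        IntervalIntegrable (arcIntegrand (dihedralXY τ) (edgeXY τ)) volume 0 π) ∧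
      (∀ σ ∈ ({1, -1} : Set ℝ),
        IntervalIntegrable (arcIntegrand (dihedralXZ σ) (edgeXZ σ)) volume 0 π) ∧
      meanWidth Ω = 1 / (2 * π) * totalMeanCurvature + 1 / (4 * π) * totalDihedral ∧
      meanWidth Ω =
        4 / (2 * π) * (∫ x in (-1 : ℝ)..1, ∫ _y in (0 : ℝ)..√(1 - x ^ 2),
            1 / ((2 - x ^ 2) * √(1 - x ^ 2)))
          + 8 / (4 * π) * ∫ θ in (0 : ℝ)..π, arccos (1 / √(2 - cos θ ^ 2))) ∧
    -- the support functions and the direct double integral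
    ((∀ v : E3, supportFun diskXY v = √(v 0 ^ 2 + v 1 ^ 2) ∧
        supportFun diskXZ v = √(v 0 ^ 2 + v 2 ^ 2) ∧
        supportFun Ω v = max (supportFun diskXY v) (supportFun diskXZ v)) ∧
      meanWidth Ω =
        2 * ∫ θ in (0 : ℝ)..(π / 2), ∫ φ in (0 : ℝ)..(π / 2),
          max (sin φ) (√(cos θ ^ 2 * sin φ ^ 2 + cos φ ^ 2)) * (2 / π) * sin φ ∧
      meanWidth Ω =
        8 / π * ∫ θ in (0 : ℝ)..(π / 2),
          ∫ φ in (arccos (sin θ / √(2 - cos θ ^ 2)))..(π / 2), sin φ ^ 2) := by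
  refine ⟨⟨integrable_width_body, meanWidth_body_closed_form⟩, meanWidth_body_digits,
    ⟨frontier_body, fun σ hσ τ hτ x y hx _ _ => ⟨norm_faceNormal hσ hτ y hx,
      fun q hq => inner_faceNormal_sub_le hσ hτ hx hq⟩⟩,
    ⟨fun σ hσ τ hτ => integrableOn_faceIntegrand hσ hτ, fun τ hτ => (edgeXY_integral hτ).1,
      fun σ hσ => (edgeXZ_integral hσ).1, meanWidth_body_eq_curvature, ?_⟩,
    ⟨fun v => ⟨supportFun_diskXY v, supportFun_diskXZ v, ?_⟩, meanWidth_body_eq_octant,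
      meanWidth_body_eq_sector⟩⟩
  · rw [meanWidth_body_eq_curvature, totalMeanCurvature_eq, totalDihedral_eq,
      integral_iterated_curvature]
    ring
  · rw [supportFun_body, supportFun_diskXY, supportFun_diskXZ]
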